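/- Let $n\ge 1$ and let $B_{2n}$ be the braid group on $2n$ strands, with Artin generators $\sigma_1,\dots,\sigma_{2n-1}$. Let $<_D$ be the Dehornoy order on $B_{2n}$: $\alpha<_D\beta$ if and only if $\alpha^{-1}\beta$ is represented by a braid word which, for some $i$, contains $\sigma_i$ but neither $\sigma_i^{-1}$ nor any $\sigma_j^{\pm1}$ with $j<i$. Let $\tau_n\subset B^3$ be the standard trivial $n$-string tangle, whose strings join $2n$ marked points of $\partial B^3$ in adjacent pairs, and let $H_{2n}\le B_{2n}$ be the Hilden subgroup, that is, the subgroup of braids whose action on $\partial B^3$ with its $2n$ marked points extends to a homeomorphism of the pair $(B^3,\tau_n)$. Let $\mathcal P_{2n}=H_{2n}\backslash B_{2n}/H_{2n}$ be the set of Hilden double cosets. Let $c_n\colon B_{2n}\to\mathbb N$ be a proper complexity function, that is, a function such that $\{\beta\in B_{2n}\mid c_n(\beta)\le N\}$ is finite for every $N\in\mathbb N$. For $C\in\mathcal P_{2n}$ put \[ c_n(C)=\min\{c_n(\beta)\mid\beta\in C\},\qquad M_n(C)=\{\beta\in C\mid c_n(\beta)=c_n(C)\}. \] Then, for every $C\in\mathcal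 P_{2n}$, the set $M_n(C)$ is finite and nonempty and has a unique $<_D$-least element $r_{D,n}(C)$; and the relation $\prec_{D,n}$ on $\mathcal P_{2n}$ defined by \[ C_1\prec_{D,n}C_2\iff r_{D,n}(C_1)<_D r_{D,n}(C_2) \] is a strict total order on $\mathcal P_{2n}$. -/

import Mathlib

open scoped NNReal

noncomputable section

namespace Plat

/-! ### The braid group and the Dehornoy order -/

/-- Artin's relations on the generators `σ₁, …, σ_{m-1}`, which are indexed here from `0`. -/
def artinRels (m : ℕ) : Set (FreeGroup (Fin (m - 1))) :=
  {r | ∃ i j : Fin (m - 1), (i : ℕ) + 2 ≤ j ∧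
      r = .of i * .of j * (.of j * .of i)⁻¹} ∪
  {r | ∃ i j : Fin (m - 1), (i : ℕ) + 1 = j ∧
      r = .of i * .of j * .of i * (.of j * .of i * .of j)⁻¹}

/-- The braid group on `m` strands. -/
abbrev Braid (m : ℕ) : Type := PresentedGroup (artinRels m)

/-- The braid represented by a braid word; `(i, true)` stands for the generator with index `i`
and `(i, false)` for its inverse. -/
def wordBraid {m : ℕ} (w : List (Fin (m - 1) × Bool)) : Braid m :=
  PresentedGroup.mk (artinRels m) (FreeGroup.mk w)

/-- A braid word is `σ`-positive if, for the least index `i` occurring in it, the generator with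
index `i` occurs and its inverse does not. -/
def SigmaPositive {m : ℕ} (w : List (Fin (m - 1) × Bool)) : Prop :=
  ∃ i, (i, true) ∈ w ∧ (i, false) ∉ w ∧ ∀ x ∈ w, i ≤ x.1

/-- The Dehornoy order: `α <_D β` if `α⁻¹ β` is represented by a `σ`-positive word. -/
def DehornoyLT {m : ℕ} (α β : Braid m) : Prop :=
  ∃ w : List (Fin (m - 1) × Bool), SigmaPositive w ∧ wordBraid w = α⁻¹ * β

/-! ### Half twists of the plane

The marked points are `0, 1, …, 2n - 1` in `ℂ`. -/

/-- The angle of the half twist at distance `r` from its centre: `π` for `r ≤ 1/2`, `0` for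
`r ≥ 1`, and linear in between. -/
def twistAngle (r : ℝ) : ℝ := Real.pi * max 0 (min 1 (2 - 2 * r))

/-- Rotation of each circle about `c` by `s` times the angle that belongs to its radius. -/
def twistFun (c : ℂ) (s : ℝ) (z : ℂ) : ℂ :=
  c + Complex.exp ((s * twistAngle ‖z - c‖ : ℝ) * Complex.I) * (z - c)

theorem twistFun_neg (c : ℂ) (s : ℝ) (z : ℂ) : twistFun c (-s) (twistFun c s z) = z := by
  have h : ‖twistFun c s z - c‖ = ‖z - c‖ := by
    simp only [twistFun, add_sub_cancel_left, norm_mul, Complex.norm_exp_ofReal_mul_I, one_mul]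
  unfold twistFun at h ⊢
  rw [h, add_sub_cancel_left, ← mul_assoc, ← Complex.exp_add]
  simp

theorem continuous_twistFun (c : ℂ) (s : ℝ) : Continuous (twistFun c s) := by
  unfold twistFun twistAngle
  fun_prop

/-- The half twist exchanging the marked points `i` and `i + 1`; it is supported in the disc of
radius `1` about `i + 1/2`, which contains no other marked point. -/
def halfTwist (i : ℕ) : ℂ ≃ₜ ℂ where
  toFun := twistFun ((i : ℂ) + 1 / 2) 1
  invFun := twistFun ((i : ℂ) + 1 / 2) (-1)
  left_inv z := twistFun_neg _ 1 z
  right_inv z := by simpa using twistFun_neg ((i : ℂ) + 1 / 2) (-1) z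
  continuous_toFun := continuous_twistFun _ _
  continuous_invFun := continuous_twistFun _ _

/-- The action of braid words on the plane with its marked points. Words that represent the same
braid act by homeomorphisms that are isotopic relative to the marked points. -/
def wordAction (m : ℕ) : FreeGroup (Fin (m - 1)) →* (ℂ ≃ₜ ℂ) :=
  FreeGroup.lift fun i => halfTwist i

/-! ### The Hilden subgroup -/

/-- The closed 3-ball, as the closed upper half-space together with its point at infinity. Its
boundary sphere is `ℂ × {0}` together with the point at infinity. -/
abbrev Ball3 : Type := OnePoint (ℂ × ℝ≥0)

/-- The standard trivial `n`-string tangle in the ball: for each `j < n` a semicircle that joins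
the adjacent marked points `2j` and `2j + 1`. -/
def trivialTangle (n : ℕ) : Set Ball3 :=
  {p | ∃ j < n, ∃ (x : ℝ) (t : ℝ≥0), (x - (2 * j + 1 / 2)) ^ 2 + (t : ℝ) ^ 2 = 1 / 4 ∧
    p = (((x : ℂ), t) : ℂ × ℝ≥0)}

/-- `F` is a homeomorphism of the pair (ball, tangle) that restricts to `f` on the boundary
sphere. -/
def Extends (n : ℕ) (f : ℂ ≃ₜ ℂ) (F : Ball3 ≃ₜ Ball3) : Prop :=
  F OnePoint.infty = OnePoint.infty ∧
  (∀ z : ℂ, F ((z, 0) : ℂ × ℝ≥0) = ((f z, 0) : ℂ × ℝ≥0)) ∧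
  F '' trivialTangle n = trivialTangle n

/-- The homeomorphisms of the boundary sphere (fixing infinity) that extend to a homeomorphism of
the ball preserving the standard trivial tangle. -/
def extendable (n : ℕ) : Subgroup (ℂ ≃ₜ ℂ) where
  carrier := {f | ∃ F, Extends n f F}
  one_mem' := ⟨1, rfl, fun _ => rfl, Set.image_id _⟩
  mul_mem' := by
    rintro f g ⟨F, hF, hF', hF''⟩ ⟨G, hG, hG', hG''⟩
    refine ⟨F * G, ?_, fun z => ?_, ?_⟩
    · change F (G _) = _
      rw [hG, hF]
    · change F (G _) = _
      rw [hG', hF']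
      rfl
    · change (F ∘ G) '' _ = _
      rw [Set.image_comp, hG'', hF'']
  inv_mem' := by
    rintro f ⟨F, hF, hF', hF''⟩
    refine ⟨F.symm, ?_, fun z => ?_, ?_⟩
    · rw [Homeomorph.symm_apply_eq, hF]
    · rw [Homeomorph.symm_apply_eq, hF']
      change _ = (((f (f.symm z), 0) : ℂ × ℝ≥0) : Ball3)
      rw [Homeomorph.apply_symm_apply]
    · conv_lhs => rw [← hF'']
      rw [← Set.image_comp]
      simp

/-- The Hilden subgroup `H_{2n}` of the braid group on `2n` strands: the braids whose action on
the boundary sphere with its `2n` marked points extends to a homeomorphism of the pair (ball,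
standard trivial tangle). Whether it extends depends only on the isotopy class relative to the
marked points, so it does not matter which word represents the braid. -/
def hilden (n : ℕ) : Subgroup (Braid (2 * n)) :=
  ((extendable n).comap (wordAction (2 * n))).map (PresentedGroup.mk (artinRels (2 * n)))

/-- The set `P_{2n} = H_{2n} \ B_{2n} / H_{2n}` of Hilden double cosets. -/
abbrev PlatClass (n : ℕ) : Type :=
  DoubleCoset.Quotient (hilden n : Set (Braid (2 * n))) (hilden n : Set (Braid (2 * n)))

/-- A Hilden double coset as a set of braids. -/
def PlatClass.braids {n : ℕ} (C : PlatClass n) : Set (Braid (2 * n)) :=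
  {β | DoubleCoset.mk (hilden n) (hilden n) β = C}

/-! ### Complexity and canonical representatives -/

/-- A proper complexity function: all sublevel sets are finite. -/
def IsProperComplexity {n : ℕ} (c : Braid (2 * n) → ℕ) : Prop :=
  ∀ N : ℕ, {β | c β ≤ N}.Finite

/-- The least complexity of a braid in the double coset `C` (the set is never empty). -/
def classComplexity {n : ℕ} (c : Braid (2 * n) → ℕ) (C : PlatClass n) : ℕ :=
  sInf (c '' C.braids)

/-- The set `M_n(C)` of braids of least complexity in `C`. -/
def minimalBraids {n : ℕ} (c : Braid (2 * n) → ℕ) (C : PlatClass n) : Set (Braid (2 * n)) :=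
  {β | β ∈ C.braids ∧ c β = classComplexity c C}

/-- `β` is a least element of `S` for the Dehornoy order. -/
def IsDehornoyLeast {m : ℕ} (S : Set (Braid m)) (β : Braid m) : Prop :=
  β ∈ S ∧ ∀ γ ∈ S, γ = β ∨ DehornoyLT β γ

/-- The Dehornoy canonical representative `r_{D,n}(C)`: the Dehornoy-least braid in `M_n(C)`. That
such a braid exists and is unique is part of what has to be proved. -/
def canonicalRep {n : ℕ} (c : Braid (2 * n) → ℕ) (C : PlatClass n) : Braid (2 * n) :=
  Classical.epsilon (IsDehornoyLeast (minimalBraids c C))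

/-- The relation `C₁ ≺_{D,n} C₂`. -/
def PlatLT {n : ℕ} (c : Braid (2 * n) → ℕ) (C₁ C₂ : PlatClass n) : Prop :=
  DehornoyLT (canonicalRep c C₁) (canonicalRep c C₂)

end Plat

end

/-! The only substantial point is that the Dehornoy order is a strict total order; a finite set of
braids then has a unique least element, and double cosets are compared through an injection into
the braid group.

The braid group acts faithfully on a free group (Artin), sending each generator `x_j` to a
conjugate of a generator. Let `β` be a product of `σ_j^{±1}` with `j ≥ i`. If `σ_i^{-1}` does not
occur in it, then `β` sends reduced words that begin with `x_i` to such words. As `σ_i^{-1}` sends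
`x_i` to `x_{i+1}`, such a `β` is not trivial if its word contains `σ_i`.

Conversely, whether `β` or `β⁻¹` can be written without `σ_i^{-1}` is decided by whether the reduced
word of `β x_i` begins with `x_i`. Multiply `β` on the right by a product of `σ_j^{±1}` with `j > i`
so that the images of the generators have minimal total length. Then hardly anything cancels in the
product of the images of `x_{i+1}, …, x_{m-1}`. But that product is `(β x_i)⁻¹ x_i ⋯ x_{m-1}`, since
`β` fixes `x_i ⋯ x_{m-1}`; hence the middle letter of one of the images lies inside the word of
`β x_i`. Moving the corresponding strand to place `i` shortens the image of `x_i`, and one can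
proceed by induction until `x_i` is fixed; then `σ_i` is not needed at all. -/

namespace Plat

open FreeGroup (of mk IsReduced invRev)

/-! ### Reduced words in free groups -/

section FreeGroup

variable {α β : Type*}

theorem head?_invRev (L : List (α × Bool)) :
    (invRev L).head? = L.getLast?.map fun a => (a.1, !a.2) := by
  simp [invRev]

theorem getLast?_invRev (L : List (α × Bool)) :
    (invRev L).getLast? = L.head?.map fun a => (a.1, !a.2) := by
  simp [invRev]

theorem isReduced_append {L₁ L₂ : List (α × Bool)} (h₁ : IsReduced L₁) (h₂ : IsReduced L₂)
    (h : ∀ a, L₁.getLast? = some a → L₂.head? ≠ some (a.1, !a.2)) : IsReduced (L₁ ++ L₂) := by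
  refine List.IsChain.append h₁ h₂ fun a ha b hb hab => ?_
  by_contra hne
  exact h a ha (by rw [hb, ← Bool.eq_not.2 (Ne.symm hne), hab])

theorem isReduced_of_forall_true {L : List (α × Bool)} (h : ∀ a ∈ L, a.2 = true) : IsReduced L :=
  List.Pairwise.isChain <|
    List.pairwise_of_forall_mem_list fun a ha b hb _ => by rw [h a ha, h b hb]

theorem exists_split_of_red_cons {L R : List (α × Bool)} {a : α × Bool}
    (h : FreeGroup.Red L (a :: R)) : ∃ L₁ L₂, L = L₁ ++ a :: L₂ ∧ mk L₁ = 1 := by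
  induction h using Relation.ReflTransGen.head_induction_on with
  | refl => exact ⟨[], R, rfl, rfl⟩
  | @head L L' hstep _ ih =>
    obtain ⟨P, Q, hPQ, hP⟩ := ih
    cases hstep with
    | @not X Y c e =>
      rcases List.append_eq_append_iff.1 hPQ with ⟨Z, rfl, rfl⟩ | ⟨Z, rfl, hZ⟩
      · refine ⟨X ++ (c, e) :: (c, !e) :: Z, Q, by simp, ?_⟩
        rw [← hP]
        exact Quot.sound FreeGroup.Red.Step.not
      · rcases Z with _ | ⟨b, Z⟩
        · obtain rfl : Y = a :: Q := by simpa using hZ.symm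
          refine ⟨P ++ [(c, e), (c, !e)], Q, by simp, ?_⟩
          rw [← hP, ← List.append_nil P, List.append_assoc]
          exact Quot.sound FreeGroup.Red.Step.not
        · obtain ⟨rfl, rfl⟩ : a = b ∧ Q = Z ++ Y := by simpa using hZ
          exact ⟨P, Z ++ (c, e) :: (c, !e) :: Y, by simp, hP⟩

theorem exists_common_prefix (L L' : List α) : ∃ C E F, L = C ++ E ∧ L' = C ++ F ∧
    ∀ a, E.head? = some a → F.head? ≠ some a := by
  classical
  induction L generalizing L' with
  | nil => exact ⟨[], [], L', by simp⟩
  | cons a L ih =>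
    rcases L' with _ | ⟨b, L'⟩
    · exact ⟨[], a :: L, [], by simp⟩
    · by_cases hab : a = b
      · obtain ⟨C, E, F, rfl, rfl, hne⟩ := ih L'
        exact ⟨b :: C, E, F, by simp [hab], rfl, hne⟩
      · exact ⟨[], a :: L, b :: L', rfl, rfl, by simpa using Ne.symm hab⟩

theorem map_mk_eq_mk_flatMap {φ : FreeGroup α →* FreeGroup β} {W : α × Bool → List (β × Bool)}
    (hW : ∀ a, mk (W a) = φ (mk [a])) (L : List (α × Bool)) : φ (mk L) = mk (L.flatMap W) := by
  induction L with
  | nil => exact map_one φ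
  | cons a L ih =>
    rw [List.flatMap_cons, ← FreeGroup.mul_mk, hW, ← ih, ← map_mul, FreeGroup.mul_mk,
      List.singleton_append]

theorem exists_of_flatMap_eq_append_cons {W : α → List β} {L : List α} {X Y : List β} {b : β}
    (h : L.flatMap W = X ++ b :: Y) :
    ∃ L₁ a L₂ P Q, L = L₁ ++ a :: L₂ ∧ W a = P ++ b :: Q ∧ X = L₁.flatMap W ++ P := by
  induction L generalizing X with
  | nil => simp at h
  | cons a L ih =>
    rw [List.flatMap_cons] at h
    rcases List.append_eq_append_iff.1 h with ⟨Z, rfl, hZ⟩ | ⟨_ | ⟨c, Z⟩, ha, hZ⟩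
    · obtain ⟨L₁, a', L₂, P, Q, rfl, ha', rfl⟩ := ih hZ
      exact ⟨a :: L₁, a', L₂, P, Q, rfl, ha', by simp⟩
    · obtain ⟨L₁, a', L₂, P, Q, rfl, ha', hP⟩ := ih (X := []) hZ.symm
      exact ⟨a :: L₁, a', L₂, P, Q, rfl, ha', by simp [ha, ← hP]⟩
    · obtain ⟨rfl, -⟩ : b = c ∧ _ := by simpa using hZ
      exact ⟨[], a, L, X, Z, rfl, ha, by simp⟩

variable [DecidableEq α] [DecidableEq β]

theorem toWord_mk_of_isReduced {L : List (α × Bool)} (h : IsReduced L) : (mk L).toWord = L := by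
  rw [FreeGroup.toWord_mk, h.reduce_eq]

theorem toWord_mul_of_getLast?_ne {g h : FreeGroup α}
    (hgh : ∀ a, g.toWord.getLast? = some a → h.toWord.head? ≠ some (a.1, !a.2)) :
    (g * h).toWord = g.toWord ++ h.toWord := by
  rw [FreeGroup.toWord_mul,
    (isReduced_append FreeGroup.isReduced_toWord FreeGroup.isReduced_toWord hgh).reduce_eq]

theorem exists_toWord_inv_mul (g h : FreeGroup α) :
    ∃ C E F, g.toWord = C ++ E ∧ h.toWord = C ++ F ∧ (g⁻¹ * h).toWord = invRev E ++ F := by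
  obtain ⟨C, E, F, hg, hh, hne⟩ := exists_common_prefix g.toWord h.toWord
  refine ⟨C, E, F, hg, hh, ?_⟩
  have hE : IsReduced E := List.IsChain.right_of_append (hg ▸ FreeGroup.isReduced_toWord)
  have hF : IsReduced F := List.IsChain.right_of_append (hh ▸ FreeGroup.isReduced_toWord)
  have hgh : g⁻¹ * h = (mk E)⁻¹ * mk F := by
    rw [← FreeGroup.mk_toWord (x := g), ← FreeGroup.mk_toWord (x := h), hg, hh,
      ← FreeGroup.mul_mk, ← FreeGroup.mul_mk]
    group
  rw [hgh, toWord_mul_of_getLast?_ne] <;>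
    simp only [FreeGroup.toWord_inv, toWord_mk_of_isReduced hE, toWord_mk_of_isReduced hF]
  simp only [getLast?_invRev, Option.map_eq_some_iff]
  rintro _ ⟨a, ha, rfl⟩
  simpa using hne a ha

/-- The first letter of the image of `u` survives from the image of one of the letters of `u`. -/
theorem exists_of_head?_map {φ : FreeGroup α →* FreeGroup β} {W : α × Bool → List (β × Bool)}
    (hW : ∀ a, mk (W a) = φ (mk [a])) {u : FreeGroup α} {b : β × Bool}
    (h : (φ u).toWord.head? = some b) :
    ∃ L₁ a L₂ P Q, u.toWord = L₁ ++ a :: L₂ ∧ W a = P ++ b :: Q ∧ φ (mk L₁) * mk P = 1 := by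
  obtain ⟨R, hR⟩ := List.head?_eq_some_iff.1 h
  rw [← FreeGroup.mk_toWord (x := u), map_mk_eq_mk_flatMap hW, FreeGroup.toWord_mk] at hR
  obtain ⟨X, Y, hXY, hX⟩ := exists_split_of_red_cons (hR ▸ FreeGroup.reduce.red)
  obtain ⟨L₁, a, L₂, P, Q, hu, ha, rfl⟩ := exists_of_flatMap_eq_append_cons hXY
  exact ⟨L₁, a, L₂, P, Q, hu, ha, by rw [map_mk_eq_mk_flatMap hW, FreeGroup.mul_mk, hX]⟩

end FreeGroup

/-! ### Conjugates of generators -/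

section Arc

variable {α : Type*}

/-- The conjugate of the generator `k` by `A`. Braids send generators to such elements, which are
the classes of loops that run along an arc to a puncture and back. -/
def arc (A : FreeGroup α) (k : α) : FreeGroup α := A * of k * A⁻¹

theorem one_arc (k : α) : arc 1 k = of k := by simp [arc]

theorem mul_arc_mul_inv (g A : FreeGroup α) (k : α) : g * arc A k * g⁻¹ = arc (g * A) k := by
  simp [arc, mul_assoc]

theorem map_arc {β : Type*} (φ : FreeGroup α →* FreeGroup β) {k : α} {C : FreeGroup β} {l : β}
    (h : φ (of k) = arc C l) (A : FreeGroup α) : φ (arc A k) = arc (φ A * C) l := by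
  simp [arc, h, mul_assoc]

variable [DecidableEq α] {A B : FreeGroup α} {k l : α}

/-- The reduced word of `A` does not end in the generator `k` or its inverse, so that the obvious
word for `arc A k` is reduced. -/
def Tight (A : FreeGroup α) (k : α) : Prop := ∀ e, A.toWord.getLast? ≠ some (k, e)

theorem exists_tight (B : FreeGroup α) (k : α) :
    ∃ A E, B.toWord = A.toWord ++ E ∧ (∀ a ∈ E, a.1 = k) ∧ Tight A k ∧ arc B k = arc A k := by
  suffices ∀ D : List (α × Bool), ∃ A E, D = A ++ E ∧ (∀ a ∈ E, a.1 = k) ∧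
      (∀ e, A.getLast? ≠ some (k, e)) ∧ arc (mk D) k = arc (mk A) k by
    obtain ⟨A, E, hB, hE, hA, harc⟩ := this B.toWord
    have hA' : (mk A).toWord = A :=
      toWord_mk_of_isReduced (List.IsChain.left_of_append (hB ▸ FreeGroup.isReduced_toWord))
    exact ⟨mk A, E, by rwa [hA'], hE, by rwa [Tight, hA'], by rw [← harc, FreeGroup.mk_toWord]⟩
  intro D
  induction D using List.reverseRecOn with
  | nil => exact ⟨[], [], by simp⟩
  | append_singleton D a ih =>
    by_cases h : a.1 = k
    · obtain ⟨A, E, rfl, hE, hA, harc⟩ := ih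
      refine ⟨A, E ++ [a], by simp, by simpa [or_imp, forall_and, h] using hE, hA, ?_⟩
      have hcomm : Commute (mk [a]) (of k) := by
        obtain ⟨k', _ | _⟩ := a <;> obtain rfl := h
        exacts [(Commute.refl (of k')).inv_left, Commute.refl _]
      rw [← harc, ← FreeGroup.mul_mk, arc, mul_assoc _ (mk [a]), hcomm.eq, arc]
      group
    · exact ⟨D ++ [a], [], by simp [Prod.ext_iff, h]⟩

theorem exists_tight_of_isConj {g : FreeGroup α} (h : IsConj (of k) g) :
    ∃ A, Tight A k ∧ g = arc A k := by
  obtain ⟨B, rfl⟩ := isConj_iff.1 h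
  obtain ⟨A, -, -, -, hA, harc⟩ := exists_tight B k
  exact ⟨A, hA, harc⟩

theorem Tight.head?_inv_ne (h : Tight A k) (e : Bool) : A⁻¹.toWord.head? ≠ some (k, e) := by
  rw [FreeGroup.toWord_inv, head?_invRev]
  intro he
  obtain ⟨⟨l, e'⟩, hl, hle⟩ := Option.map_eq_some_iff.1 he
  obtain ⟨rfl, -⟩ := Prod.mk.inj hle
  exact h e' hl

theorem Tight.toWord_mul {g : FreeGroup α} {e : Bool} (h : Tight A k)
    (hg : g.toWord.head? = some (k, e)) : (A * g).toWord = A.toWord ++ g.toWord := by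
  refine toWord_mul_of_getLast?_ne fun a ha hga => h a.2 ?_
  rw [hg] at hga
  rw [ha, (Prod.mk.inj (Option.some.inj hga)).1]

theorem toWord_mk_singleton_mul {g : FreeGroup α} {e : Bool}
    (h : g.toWord.head? ≠ some (k, !e)) : (mk [(k, e)] * g).toWord = (k, e) :: g.toWord := by
  have hk : (mk [(k, e)]).toWord = [(k, e)] := toWord_mk_of_isReduced FreeGroup.IsReduced.singleton
  rw [toWord_mul_of_getLast?_ne (by simpa [hk] using h), hk, List.singleton_append]

theorem toWord_arc_inv_mul {g : FreeGroup α} (h : Tight A k)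
    (hg : (A⁻¹ * g).toWord.head? ≠ some (k, true)) :
    ((arc A k)⁻¹ * g).toWord = A.toWord ++ (k, false) :: (A⁻¹ * g).toWord := by
  have hcons := toWord_mk_singleton_mul (e := false) hg
  have hg' : (arc A k)⁻¹ * g = A * (mk [(k, false)] * (A⁻¹ * g)) := by
    simp only [arc, mul_inv_rev, inv_inv, mul_assoc]
    rfl
  rw [hg', h.toWord_mul (by rw [hcons]; rfl), hcons]

theorem toWord_arc (h : Tight A k) : (arc A k).toWord = A.toWord ++ (k, true) :: A⁻¹.toWord := by
  have hcons := toWord_mk_singleton_mul (e := true) (h.head?_inv_ne false)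
  rw [arc, mul_assoc, show of k = mk [(k, true)] from rfl, h.toWord_mul (by rw [hcons]; rfl), hcons]

theorem norm_arc (h : Tight A k) : (arc A k).norm = 2 * A.norm + 1 := by
  rw [FreeGroup.norm, toWord_arc h, List.length_append, List.length_cons, ← FreeGroup.norm,
    ← FreeGroup.norm, FreeGroup.norm_inv_eq]
  ring

theorem eq_of_arc_eq_of {α : Type*} {B : FreeGroup α} {k l : α} (h : arc B k = of l) : k = l := by
  classical
  obtain ⟨A, -, -, -, hA, harc⟩ := exists_tight B k
  have hnorm := norm_arc hA
  rw [← harc, h, FreeGroup.norm_of] at hnorm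
  obtain rfl : A = 1 := FreeGroup.norm_eq_zero.1 (by omega)
  exact FreeGroup.of_injective (by rw [← one_arc, ← harc, h])

theorem norm_arc_le (A : FreeGroup α) (k : α) : (arc A k).norm ≤ 2 * A.norm + 1 := by
  have h₁ := FreeGroup.norm_mul_le (A * of k) A⁻¹
  have h₂ := FreeGroup.norm_mul_le A (of k)
  rw [FreeGroup.norm_inv_eq] at h₁
  rw [FreeGroup.norm_of] at h₂
  rw [arc]
  omega

theorem head?_toWord_arc : (arc B k).toWord.head? = some (l, true) ↔
    B.toWord.head? = some (l, true) ∨ arc B k = of l := by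
  obtain ⟨A, E, hB, hE, hA, harc⟩ := exists_tight B k
  rw [harc, toWord_arc hA, hB]
  rcases hAw : A.toWord with _ | ⟨a, T⟩
  · obtain rfl : A = 1 := FreeGroup.toWord_eq_nil_iff.1 hAw
    rcases E with _ | ⟨b, E⟩
    · simp [one_arc, FreeGroup.of_injective.eq_iff]
    · simp +contextual [one_arc, FreeGroup.of_injective.eq_iff, ← hE b List.mem_cons_self,
        Prod.ext_iff]
  · have hof : arc A k ≠ of l := fun h => by
      simpa [hAw] using congrArg List.length ((toWord_arc hA).symm.trans (congrArg _ h))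
    simp [hof]

/-- Conjugation by the inverse of the letter at which `B` branches off `A` removes this letter. -/
theorem norm_arc_lt {e : Bool} (hA : Tight A k) (hB : Tight B l)
    (h : (A⁻¹ * B).toWord.head? = some (k, e)) :
    (arc (A * mk [(k, !e)] * A⁻¹ * B) l).norm < (arc B l).norm := by
  obtain ⟨T, hT⟩ := List.head?_eq_some_iff.1 h
  have hBw := hA.toWord_mul h
  rw [mul_inv_cancel_left, hT] at hBw
  have hBn : B.norm = A.norm + T.length + 1 := by
    simp [FreeGroup.norm, hBw, add_assoc]
  have hcancel : mk [(k, !e)] * (A⁻¹ * B) = mk T := by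
    rw [← FreeGroup.mk_toWord (x := A⁻¹ * B), hT, FreeGroup.mul_mk]
    exact Quot.sound FreeGroup.Red.Step.cons_not_rev
  have h₁ := norm_arc_le (A * mk T) l
  have h₂ := FreeGroup.norm_mul_le A (mk T)
  have h₃ : (mk T).norm ≤ T.length := FreeGroup.norm_mk_le
  rw [mul_assoc, mul_assoc, hcancel, norm_arc hB]
  omega

/-- In the product `arc A k * arc B l` the reduced word of `A⁻¹ * B` cancels neither the letter `k`
before it nor the letter `l` after it. Images of consecutive generators have this property under a
braid that minimises the total length of the images. -/
def Nonabsorbing (A : FreeGroup α) (k : α) (B : FreeGroup α) (l : α) : Prop :=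
  (A⁻¹ * B).toWord.head? ≠ some (k, false) ∧ (A⁻¹ * B).toWord.getLast? ≠ some (l, false)

theorem nonabsorbing_of_norm_le (hA : Tight A k) (hB : Tight B l)
    (h₁ : (arc B l).norm ≤ (arc A k * arc B l * (arc A k)⁻¹).norm)
    (h₂ : (arc A k).norm ≤ ((arc B l)⁻¹ * arc A k * arc B l).norm) : Nonabsorbing A k B l := by
  have harc : arc A k = A * mk [(k, !false)] * A⁻¹ := rfl
  have hinv : (arc B l)⁻¹ = B * mk [(l, !true)] * B⁻¹ := by
    simp only [arc, mul_inv_rev, inv_inv, mul_assoc]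
    rfl
  refine ⟨fun h => h₁.not_gt ?_, fun h => h₂.not_gt ?_⟩
  · rw [mul_arc_mul_inv, harc]
    exact norm_arc_lt hA hB h
  · have h' : (B⁻¹ * A).toWord.head? = some (l, true) := by
      rw [show B⁻¹ * A = (A⁻¹ * B)⁻¹ by group, FreeGroup.toWord_inv, head?_invRev, h]
      rfl
    have hconj := mul_arc_mul_inv (arc B l)⁻¹ A k
    rw [inv_inv] at hconj
    rw [hconj, hinv]
    exact norm_arc_lt hB hA h'

end Arc

/-! ### Products of conjugates of generators -/

/-- The product of the `r` generators from `a` on. The product of all generators is fixed by every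
braid, which is the identity that all comparisons of words exploit. -/
def rangeProd (a r : ℕ) : FreeGroup ℕ := mk ((List.range' a r).map (·, true))

theorem rangeProd_zero (a : ℕ) : rangeProd a 0 = 1 := rfl

theorem rangeProd_succ (a r : ℕ) : rangeProd a (r + 1) = of a * rangeProd (a + 1) r := rfl

theorem rangeProd_add (a r s : ℕ) : rangeProd a (r + s) = rangeProd a r * rangeProd (a + r) s := by
  rw [rangeProd, rangeProd, rangeProd, FreeGroup.mul_mk, ← List.map_append,
    ← List.range'_append_1]

theorem toWord_rangeProd (a r : ℕ) : (rangeProd a r).toWord = (List.range' a r).map (·, true) :=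
  toWord_mk_of_isReduced (isReduced_of_forall_true (by simp))

theorem norm_rangeProd (a r : ℕ) : (rangeProd a r).norm = r := by
  simp [FreeGroup.norm, toWord_rangeProd]

section ArcWord

theorem append_cons_eq_append_append {α : Type*} {U W X Y Z : List α} {a : α}
    (h : U ++ a :: W = X ++ Y ++ Z) :
    (∃ X', X = U ++ a :: X' ∧ W = X' ++ Y ++ Z) ∨ (∃ Y₁ Y₂, Y = Y₁ ++ a :: Y₂ ∧ U = X ++ Y₁) ∨
      ∃ Z', U = X ++ Y ++ Z' := by
  rw [List.append_assoc] at h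
  rcases List.append_eq_append_iff.1 h with ⟨_ | ⟨b, V⟩, rfl, hV⟩ | ⟨V, rfl, hV⟩
  · rcases Y with _ | ⟨b, Y⟩
    · exact .inr (.inr ⟨[], by simp⟩)
    · exact .inr (.inl ⟨[], Y, by simp_all, by simp⟩)
  · exact .inl ⟨V, by simp_all⟩
  · rcases List.append_eq_append_iff.1 hV with ⟨T, rfl, -⟩ | ⟨_ | ⟨b, T⟩, rfl, hT⟩
    · exact .inr (.inr ⟨T, by simp⟩)
    · exact .inr (.inr ⟨[], by simp⟩)
    · exact .inr (.inl ⟨V, T, by simp_all, rfl⟩)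

variable {α : Type*} [DecidableEq α] {A : ℕ → FreeGroup α} {k : ℕ → α}

/-- The word for `P⁻¹ * arc (A b) (k b) * ⋯ * arc (A (b + s - 1)) (k (b + s - 1))` in which only
the conjugators between consecutive generators are reduced. -/
def arcWord (A : ℕ → FreeGroup α) (k : ℕ → α) : FreeGroup α → ℕ → ℕ → List (α × Bool)
  | P, _, 0 => P⁻¹.toWord
  | P, b, s + 1 => (P⁻¹ * A b).toWord ++ (k b, true) :: arcWord A k (A b) (b + 1) s

theorem mk_arcWord {φ : FreeGroup ℕ →* FreeGroup α} (hφ : ∀ j, φ (of j) = arc (A j) (k j))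
    (P : FreeGroup α) (b s : ℕ) : mk (arcWord A k P b s) = P⁻¹ * φ (rangeProd b s) := by
  induction s generalizing P b with
  | zero => rw [arcWord, rangeProd_zero, map_one, mul_one, FreeGroup.mk_toWord]
  | succ s ih =>
    rw [arcWord, ← FreeGroup.mul_mk, FreeGroup.mk_toWord, ← List.singleton_append,
      ← FreeGroup.mul_mk, ih, rangeProd_succ, map_mul, hφ, arc, show mk [(k b, true)] = of (k b)
      from rfl]
    group

theorem norm_add_le_length_arcWord (P : FreeGroup α) (b s : ℕ) :
    P.norm + s ≤ (arcWord A k P b s).length := by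
  induction s generalizing P b with
  | zero => simp [arcWord, FreeGroup.norm]
  | succ s ih =>
    have hP := FreeGroup.norm_mul_le (A b) (P⁻¹ * A b)⁻¹
    rw [show A b * (P⁻¹ * A b)⁻¹ = P by group, FreeGroup.norm_inv_eq] at hP
    have := ih (A b) (b + 1)
    rw [arcWord, List.length_append, List.length_cons, ← FreeGroup.norm]
    omega

theorem isReduced_cons_arcWord {b s : ℕ} (hA : ∀ j, Tight (A j) (k j))
    (h : ∀ j, b ≤ j → j < b + s → Nonabsorbing (A j) (k j) (A (j + 1)) (k (j + 1))) :
    IsReduced ((k b, true) :: arcWord A k (A b) (b + 1) s) := by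
  induction s generalizing b with
  | zero =>
    exact isReduced_append .singleton FreeGroup.isReduced_toWord
      (by simpa using (hA b).head?_inv_ne false)
  | succ s ih =>
    obtain ⟨h₁, h₂⟩ := h b le_rfl (by omega)
    have hr := ih (b := b + 1) fun j hj hj' => h j (by omega) (by omega)
    rw [arcWord]
    have hr' := isReduced_append FreeGroup.isReduced_toWord hr (L₁ := ((A b)⁻¹ * A (b + 1)).toWord)
    refine isReduced_append (L₁ := [_]) .singleton (hr' ?_) ?_
    · rintro ⟨l, _ | _⟩ ha hb <;> simp_all
    · rintro a ha hb
      obtain rfl : (k b, true) = a := by simpa using ha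
      rcases hw : ((A b)⁻¹ * A (b + 1)).toWord with _ | ⟨c, T⟩ <;>
        simp_all

theorem isReduced_arcWord_one {b s : ℕ} (hA : ∀ j, Tight (A j) (k j))
    (h : ∀ j, b ≤ j → j + 1 < b + s → Nonabsorbing (A j) (k j) (A (j + 1)) (k (j + 1))) :
    IsReduced (arcWord A k 1 b s) := by
  rcases s with _ | s
  · simp [arcWord]
  · have hr := isReduced_cons_arcWord (b := b) (s := s) hA fun j hj hj' => h j hj (by omega)
    rw [arcWord, inv_one, one_mul]
    refine isReduced_append FreeGroup.isReduced_toWord hr ?_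
    rintro ⟨l, e⟩ ha hb
    obtain ⟨rfl, -⟩ := Prod.mk.inj (Option.some.inj hb)
    exact hA b e ha

/-- A subword that contains none of the letters `k j` lies in one of the conjugators between two
of them, which takes up at most half of the total length of the conjugators. -/
theorem exists_mark_of_arcWord_eq {φ : FreeGroup ℕ →* FreeGroup α}
    (hφ : ∀ j, φ (of j) = arc (A j) (k j)) {P : FreeGroup α} {b s : ℕ} {X Y Z : List (α × Bool)}
    (h : arcWord A k P b s = X ++ Y ++ Z) (hY : (X ++ Y ++ Z).length + P.norm < 2 * Y.length + s) :
    ∃ Y₁ Y₂ t, t < s ∧ Y = Y₁ ++ (k (b + t), true) :: Y₂ ∧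
      mk (X ++ Y₁) = P⁻¹ * φ (rangeProd b t) * A (b + t) := by
  induction s generalizing P b X with
  | zero =>
    have hlen := congrArg List.length h
    rw [arcWord, ← FreeGroup.norm, FreeGroup.norm_inv_eq] at hlen
    simp only [List.length_append] at hlen hY
    omega
  | succ s ih =>
    have hPA := FreeGroup.norm_mul_le P⁻¹ (A b)
    have hAPA := FreeGroup.norm_mul_le P (P⁻¹ * A b)
    rw [mul_inv_cancel_left] at hAPA
    rw [FreeGroup.norm_inv_eq] at hPA
    have hW := norm_add_le_length_arcWord (A := A) (k := k) (A b) (b + 1) s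
    have hlen := congrArg List.length h
    rw [arcWord, List.length_append, List.length_cons, ← FreeGroup.norm] at hlen
    rw [arcWord] at h
    rcases append_cons_eq_append_append h with ⟨X', rfl, hX'⟩ | ⟨Y₁, Y₂, rfl, hU⟩ | ⟨Z', hU⟩
    · obtain ⟨Y₁, Y₂, t, ht, rfl, hmk⟩ := ih hX' <| by
        simp only [List.length_append, List.length_cons] at hY ⊢
        rw [← FreeGroup.norm] at hY
        omega
      refine ⟨Y₁, Y₂, t + 1, by omega, by rw [Nat.add_right_comm b, add_assoc b], ?_⟩
      rw [List.append_assoc, ← FreeGroup.mul_mk, FreeGroup.mk_toWord, List.cons_append,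
        ← List.singleton_append, ← FreeGroup.mul_mk, hmk, rangeProd_succ, map_mul, hφ, arc,
        show mk [(k b, true)] = of (k b) from rfl, add_right_comm b, add_assoc b]
      group
    · refine ⟨Y₁, Y₂, 0, by omega, rfl, ?_⟩
      rw [← hU, FreeGroup.mk_toWord, rangeProd_zero, map_one, mul_one, add_zero]
    · have hUlen := congrArg List.length hU
      rw [← FreeGroup.norm] at hUlen
      simp only [List.length_append] at hUlen hY hlen
      omega

theorem eq_one_and_eq_of_arcWord_eq_range' {k : ℕ → ℕ} {A : ℕ → FreeGroup ℕ} {b s : ℕ}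
    (h : arcWord A k 1 b s = (List.range' b s).map (·, true)) {j : ℕ} (hj : b ≤ j)
    (hj' : j < b + s) : A j = 1 ∧ k j = j := by
  induction s generalizing b with
  | zero => omega
  | succ s ih =>
    have hlen := congrArg List.length h
    have hW := norm_add_le_length_arcWord (A := A) (k := k) (A b) (b + 1) s
    rw [arcWord, inv_one, one_mul, List.length_append, List.length_cons, ← FreeGroup.norm,
      List.length_map, List.length_range'] at hlen
    have hA : A b = 1 := FreeGroup.norm_eq_zero.1 (by omega)
    rw [arcWord, List.range'_succ, List.map_cons, hA] at h
    obtain ⟨hk, h⟩ : k b = b ∧ _ := by simpa using h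
    rcases hj.eq_or_lt with rfl | hj
    · exact ⟨hA, hk⟩
    · exact ih h hj (by omega)

end ArcWord

/-! ### The braid group -/

/-- The Artin generator with index `i`, and `1` if there is no such generator. -/
noncomputable def gen (m i : ℕ) : Braid m :=
  if h : i < m - 1 then PresentedGroup.of ⟨i, h⟩ else 1

section Braid

variable {m i j : ℕ}

theorem gen_of_lt (h : i < m - 1) : gen m i = PresentedGroup.of ⟨i, h⟩ := dif_pos h

theorem gen_of_le (h : m - 1 ≤ i) : gen m i = 1 := dif_neg h.not_gt

theorem commute_gen (h : i + 2 ≤ j) : Commute (gen m i) (gen m j) := by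
  by_cases hj : j < m - 1
  · rw [gen_of_lt (by omega : i < m - 1), gen_of_lt hj]
    exact PresentedGroup.mk_eq_mk_of_mul_inv_mem (.inl ⟨_, _, h, rfl⟩)
  · rw [gen_of_le (not_lt.1 hj)]
    exact Commute.one_right _

theorem gen_mul_gen_succ_mul_gen (h : i + 1 < m - 1) :
    gen m i * gen m (i + 1) * gen m i = gen m (i + 1) * gen m i * gen m (i + 1) := by
  rw [gen_of_lt (by omega : i < m - 1), gen_of_lt h]
  exact PresentedGroup.mk_eq_mk_of_mul_inv_mem (.inr ⟨_, _, rfl, rfl⟩)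

/-- The subgroup generated by the Artin generators with index at least `i`. -/
def tail (m i : ℕ) : Subgroup (Braid m) := Subgroup.closure (gen m '' Set.Ico i (m - 1))

theorem gen_mem_tail (h : i ≤ j) : gen m j ∈ tail m i := by
  by_cases hj : j < m - 1
  · exact Subgroup.subset_closure ⟨j, ⟨h, hj⟩, rfl⟩
  · rw [gen_of_le (not_lt.1 hj)]
    exact one_mem _

theorem tail_anti (h : i ≤ j) : tail m j ≤ tail m i :=
  Subgroup.closure_mono (Set.image_mono (Set.Ico_subset_Ico_left h))

theorem tail_zero (m : ℕ) : tail m 0 = ⊤ := by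
  rw [eq_top_iff, ← PresentedGroup.closure_range_of, Subgroup.closure_le]
  rintro _ ⟨j, rfl⟩
  rw [← gen_of_lt j.2]
  exact gen_mem_tail (Nat.zero_le _)

theorem tail_eq_bot (h : m - 1 ≤ i) : tail m i = ⊥ := by
  rw [tail, Set.Ico_eq_empty (by omega), Set.image_empty, Subgroup.closure_empty]

/-- The braids with a word whose letters are the generator with index `i`, but not its inverse,
and generators of greater index and their inverses. -/
def weaklyPositive (m i : ℕ) : Submonoid (Braid m) :=
  Submonoid.closure (insert (gen m i) (tail m (i + 1)))

theorem gen_mem_weaklyPositive (m i : ℕ) : gen m i ∈ weaklyPositive m i :=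
  Submonoid.subset_closure (Set.mem_insert _ _)

theorem mem_weaklyPositive_of_mem_tail {β : Braid m} (h : β ∈ tail m (i + 1)) :
    β ∈ weaklyPositive m i :=
  Submonoid.subset_closure (Set.mem_insert_of_mem _ h)

theorem weaklyPositive_le : weaklyPositive m i ≤ (tail m i).toSubmonoid := by
  rw [weaklyPositive, Submonoid.closure_le]
  exact Set.insert_subset (gen_mem_tail le_rfl) (tail_anti (Nat.le_succ i))

section Lift

variable {G : Type*} [Group G]

/-- The homomorphism out of a braid group with prescribed values on the generators. -/
def braidLift (m : ℕ) (f : ℕ → G) (hcomm : ∀ i j, i + 2 ≤ j → Commute (f i) (f j))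
    (hbraid : ∀ i, i + 1 < m - 1 → f i * f (i + 1) * f i = f (i + 1) * f i * f (i + 1)) :
    Braid m →* G :=
  PresentedGroup.toGroup (f := fun i : Fin (m - 1) => f i) (by
    rintro _ (⟨i, j, h, rfl⟩ | ⟨i, j, h, rfl⟩) <;>
      simp only [map_mul, map_inv, FreeGroup.lift_apply_of, mul_inv_eq_one]
    · exact hcomm i j h
    · rw [← h]
      exact hbraid i (h ▸ j.2))

theorem braidLift_gen {f : ℕ → G} (hcomm hbraid) (hi : i < m - 1) :
    braidLift m f hcomm hbraid (gen m i) = f i := by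
  rw [gen_of_lt hi]
  exact PresentedGroup.toGroup.of _

theorem braid_hom_ext {f g : Braid m →* G} (h : ∀ i < m - 1, f (gen m i) = g (gen m i)) : f = g :=
  PresentedGroup.ext fun i => by simpa [gen_of_lt i.2] using h i i.2

end Lift

end Braid

/-! ### Artin's action on the free group -/

/-- Artin's automorphism for the generator with index `i`, as an endomorphism. -/
def artinHom (i : ℕ) : FreeGroup ℕ →* FreeGroup ℕ :=
  FreeGroup.lift fun j => if j = i then arc (of i) (i + 1) else if j = i + 1 then of i else of j

/-- The inverse of Artin's automorphism. -/
def artinInvHom (i : ℕ) : FreeGroup ℕ →* FreeGroup ℕ :=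
  FreeGroup.lift fun j =>
    if j = i then of (i + 1) else if j = i + 1 then arc (of (i + 1))⁻¹ i else of j

/-- Artin's automorphism for the generator with index `i`. -/
def artinAut (i : ℕ) : MulAut (FreeGroup ℕ) :=
  MonoidHom.toMulEquiv (artinHom i) (artinInvHom i)
    (by
      ext j
      by_cases h : j = i <;> by_cases h' : j = i + 1 <;>
        simp_all [artinHom, artinInvHom, arc, mul_assoc])
    (by
      ext j
      by_cases h : j = i <;> by_cases h' : j = i + 1 <;>
        simp_all [artinHom, artinInvHom, arc, mul_assoc])

section ArtinAut

variable {i j : ℕ}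

theorem artinAut_of_self (i : ℕ) : artinAut i (of i) = arc (of i) (i + 1) := by
  simp [artinAut, artinHom]

theorem artinAut_of_succ (i : ℕ) : artinAut i (of (i + 1)) = of i := by
  simp [artinAut, artinHom]

theorem artinAut_of_ne (h : j ≠ i) (h' : j ≠ i + 1) : artinAut i (of j) = of j := by
  simp [artinAut, artinHom, h, h']

theorem artinAut_inv_of_self (i : ℕ) : (artinAut i)⁻¹ (of i) = of (i + 1) :=
  (MulEquiv.symm_apply_eq _).2 (artinAut_of_succ i).symm

theorem artinAut_inv_of_succ (i : ℕ) :
    (artinAut i)⁻¹ (of (i + 1)) = arc (of (i + 1))⁻¹ i := by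
  refine (MulEquiv.symm_apply_eq _).2 ?_
  simp [arc, artinAut_of_self, artinAut_of_succ, mul_assoc]

theorem artinAut_inv_of_ne (h : j ≠ i) (h' : j ≠ i + 1) : (artinAut i)⁻¹ (of j) = of j :=
  (MulEquiv.symm_apply_eq _).2 (artinAut_of_ne h h').symm

theorem isConj_artinAut (i j : ℕ) : IsConj (artinAut i (of j)) (of (Equiv.swap i (i + 1) j)) := by
  rcases eq_or_ne j i with rfl | h
  · rw [Equiv.swap_apply_left, artinAut_of_self]
    exact (isConj_iff.2 ⟨_, rfl⟩).symm
  rcases eq_or_ne j (i + 1) with rfl | h'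
  · rw [Equiv.swap_apply_right, artinAut_of_succ]
  · rw [Equiv.swap_apply_of_ne_of_ne h h', artinAut_of_ne h h']

theorem mulAut_ext {f g : MulAut (FreeGroup ℕ)} (h : ∀ j, f (of j) = g (of j)) : f = g :=
  MulEquiv.toMonoidHom_injective (FreeGroup.ext_hom _ _ h)

theorem commute_artinAut (h : i + 2 ≤ j) : Commute (artinAut i) (artinAut j) := by
  refine mulAut_ext fun k => ?_
  simp only [MulAut.mul_apply]
  grind [artinAut_of_self, artinAut_of_succ, artinAut_of_ne, arc]

theorem artinAut_mul_artinAut_succ_mul_artinAut (i : ℕ) :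
    artinAut i * artinAut (i + 1) * artinAut i =
      artinAut (i + 1) * artinAut i * artinAut (i + 1) := by
  have h₁ : artinAut (i + 1) (of i) = of i := artinAut_of_ne (by omega) (by omega)
  have h₂ : artinAut i (of (i + 1 + 1)) = of (i + 1 + 1) := artinAut_of_ne (by omega) (by omega)
  refine mulAut_ext fun k => ?_
  simp only [MulAut.mul_apply]
  by_cases hk : k = i
  · simp [hk, artinAut_of_self, artinAut_of_succ, arc, h₁, h₂, mul_assoc]
  by_cases hk' : k = i + 1
  · simp [hk', artinAut_of_self, artinAut_of_succ, arc, h₁, h₂]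
  by_cases hk'' : k = i + 1 + 1
  · simp [hk'', artinAut_of_succ, h₁, h₂]
  · simp [artinAut_of_ne hk hk', artinAut_of_ne hk' hk'']

end ArtinAut

/-- Artin's representation of the braid group on `m` strands. -/
def artin (m : ℕ) : Braid m →* MulAut (FreeGroup ℕ) :=
  braidLift m artinAut (fun _ _ h => commute_artinAut h)
    fun i _ => artinAut_mul_artinAut_succ_mul_artinAut i

section Artin

variable {m i j : ℕ} {β : Braid m}

theorem artin_gen (hi : i < m - 1) : artin m (gen m i) = artinAut i := braidLift_gen _ _ hi

theorem artin_inv_apply_eq_iff {z w : FreeGroup ℕ} :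
    artin m β⁻¹ z = w ↔ z = artin m β w := by
  rw [map_inv]
  exact MulEquiv.symm_apply_eq _

theorem artin_apply_eq_of_mem_tail (hβ : β ∈ tail m i) {z : FreeGroup ℕ}
    (h : ∀ j, i ≤ j → j < m - 1 → artinAut j z = z) : artin m β z = z := by
  suffices tail m i ≤ (MulAction.stabilizer (MulAut (FreeGroup ℕ)) z).comap (artin m) from this hβ
  rw [tail, Subgroup.closure_le]
  rintro _ ⟨j, ⟨hj, hj'⟩, rfl⟩
  change artin m (gen m j) z = z
  rw [artin_gen hj', h j hj hj']

theorem artin_of_lt (hβ : β ∈ tail m i) (hj : j < i) : artin m β (of j) = of j :=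
  artin_apply_eq_of_mem_tail hβ fun _ _ _ => artinAut_of_ne (by omega) (by omega)

theorem artin_of_le (β : Braid m) (hj : m ≤ j) : artin m β (of j) = of j :=
  artin_apply_eq_of_mem_tail (i := 0) (by simp [tail_zero]) fun _ _ _ =>
    artinAut_of_ne (by omega) (by omega)

theorem artinAut_rangeProd {a r : ℕ} (h : a ≤ j) (h' : j + 1 < a + r) :
    artinAut j (rangeProd a r) = rangeProd a r := by
  have hfix : ∀ b s, (∀ k, b ≤ k → k < b + s → k ≠ j ∧ k ≠ j + 1) →
      artinAut j (rangeProd b s) = rangeProd b s := by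
    intro b s
    induction s generalizing b with
    | zero => simp [rangeProd_zero]
    | succ s ih =>
      intro hk
      obtain ⟨hb, hb'⟩ := hk b le_rfl (by omega)
      rw [rangeProd_succ, map_mul, artinAut_of_ne hb hb',
        ih (b + 1) fun k _ _ => hk k (by omega) (by omega)]
  obtain ⟨t, rfl⟩ := Nat.exists_eq_add_of_le h
  obtain ⟨s, rfl⟩ : ∃ s, r = t + (s + 2) := ⟨r - t - 2, by omega⟩
  rw [rangeProd_add, rangeProd_succ, rangeProd_succ, map_mul, map_mul, map_mul,
    hfix a t (by omega), hfix (a + t + 1 + 1) s (by omega), artinAut_of_self, artinAut_of_succ, arc]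
  group

theorem artin_rangeProd (hβ : β ∈ tail m i) {r : ℕ} (h : m ≤ i + r) :
    artin m β (rangeProd i r) = rangeProd i r :=
  artin_apply_eq_of_mem_tail hβ fun _ _ _ => artinAut_rangeProd (by omega) (by omega)

theorem exists_perm_isConj_artin (β : Braid m) :
    ∃ π : Equiv.Perm ℕ, ∀ j, IsConj (artin m β (of j)) (of (π j)) := by
  have hβ : β ∈ tail m 0 := by simp [tail_zero]
  induction hβ using Subgroup.closure_induction with
  | mem _ h =>
    obtain ⟨i, hi, rfl⟩ := h
    exact ⟨Equiv.swap i (i + 1), fun j => artin_gen hi.2 ▸ isConj_artinAut i j⟩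
  | one => exact ⟨1, fun j => by rw [map_one]; exact IsConj.refl _⟩
  | mul β γ _ _ hβ hγ =>
    obtain ⟨π, hπ⟩ := hβ
    obtain ⟨ρ, hρ⟩ := hγ
    exact ⟨π * ρ, fun j => by
      simpa using ((artin m β).toMonoidHom.map_isConj (hρ j)).trans (hπ (ρ j))⟩
  | inv β _ hβ =>
    obtain ⟨π, hπ⟩ := hβ
    exact ⟨π⁻¹, fun j => by
      simpa using ((artin m β⁻¹).toMonoidHom.map_isConj (hπ (π⁻¹ j))).symm⟩

theorem exists_tight_artin (β : Braid m) (j : ℕ) :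
    ∃ A k, Tight A k ∧ artin m β (of j) = arc A k := by
  obtain ⟨π, hπ⟩ := exists_perm_isConj_artin β
  obtain ⟨A, hA, h⟩ := exists_tight_of_isConj (hπ j).symm
  exact ⟨A, π j, hA, h⟩

end Artin

/-! ### Faithfulness of Artin's representation -/

/-- The inclusion of the braid group on `N` strands into the one on `N + 1` strands. -/
noncomputable def incl (N : ℕ) : Braid N →* Braid (N + 1) :=
  braidLift N (gen (N + 1)) (fun _ _ h => commute_gen h)
    fun _ h => gen_mul_gen_succ_mul_gen (by omega)

/-- The braid `σ_i ⋯ σ_{N-1}` (indices from `0`), which moves the last strand to place `i`. -/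
noncomputable def lastStrand (N i : ℕ) : Braid (N + 1) :=
  ((List.range' i (N - i)).map (gen (N + 1))).prod

/-- The pure braid in which the last strand goes once around strand `i`. -/
noncomputable def loop (N i : ℕ) : Braid (N + 1) :=
  (lastStrand N i)⁻¹ * (gen (N + 1) i)⁻¹ * lastStrand N (i + 1)

/-- The homomorphism that sends the free generators to the loops of the last strand. -/
noncomputable def pushHom (N : ℕ) : FreeGroup ℕ →* Braid (N + 1) :=
  FreeGroup.lift fun i => if i < N then loop N i else 1

section Combing

variable {N i j : ℕ}

theorem incl_gen (hj : j < N - 1) : incl N (gen N j) = gen (N + 1) j := braidLift_gen _ _ hj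

theorem artin_incl (b : Braid N) : artin (N + 1) (incl N b) = artin N b := by
  suffices h : (artin (N + 1)).comp (incl N) = artin N from DFunLike.congr_fun h b
  refine braid_hom_ext fun i hi => ?_
  rw [MonoidHom.comp_apply, incl_gen hi, artin_gen hi, artin_gen (by omega)]

theorem lastStrand_self (N : ℕ) : lastStrand N N = 1 := by simp [lastStrand]

theorem lastStrand_of_lt (h : i < N) :
    lastStrand N i = gen (N + 1) i * lastStrand N (i + 1) := by
  rw [lastStrand, show N - i = N - (i + 1) + 1 by omega, List.range'_succ, List.map_cons,
    List.prod_cons, lastStrand]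

theorem commute_lastStrand_gen (h : j + 1 < i) : Commute (lastStrand N i) (gen (N + 1) j) := by
  refine Commute.list_prod_left _ _ fun g hg => ?_
  obtain ⟨k, hk, rfl⟩ := List.mem_map.1 hg
  have := List.mem_range'_1.1 hk
  exact (commute_gen (by omega)).symm

theorem semiconjBy_lastStrand_gen (h : i ≤ j) (hj : j + 1 < N) :
    SemiconjBy (lastStrand N i) (gen (N + 1) j) (gen (N + 1) (j + 1)) := by
  induction h using Nat.decreasingInduction with
  | self =>
    rw [lastStrand_of_lt (by omega : j < N), lastStrand_of_lt hj, ← mul_assoc]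
    refine SemiconjBy.mul_left ?_ (commute_lastStrand_gen (by omega))
    rw [SemiconjBy, gen_mul_gen_succ_mul_gen (by omega), mul_assoc]
  | of_succ i hi ih =>
    rw [lastStrand_of_lt (by omega)]
    exact SemiconjBy.mul_left (commute_gen (by omega)) ih

theorem loop_eq (h : i < N) :
    loop N i = (lastStrand N (i + 1))⁻¹ * (gen (N + 1) i ^ 2)⁻¹ * lastStrand N (i + 1) := by
  rw [loop, lastStrand_of_lt h]
  group

theorem loop_eq_of_succ_lt (h : i + 1 < N) :
    loop N i = (lastStrand N (i + 2))⁻¹ * ((gen (N + 1) (i + 1))⁻¹ * (gen (N + 1) i ^ 2)⁻¹ *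
      gen (N + 1) (i + 1)) * lastStrand N (i + 2) := by
  rw [loop_eq (by omega), lastStrand_of_lt h]
  group

theorem commute_loop_gen (hi : i < N) (hj : j < N - 1) (h : i ≠ j) (h' : i ≠ j + 1) :
    Commute (loop N i) (gen (N + 1) j) := by
  rcases h.lt_or_gt with h | h
  · have hi := (semiconjBy_lastStrand_gen h.le (by omega : j + 1 < N)).inv_symm_left
    have hi' := semiconjBy_lastStrand_gen h (by omega : j + 1 < N)
    have hg : Commute (gen (N + 1) i)⁻¹ (gen (N + 1) (j + 1)) := (commute_gen (by omega)).inv_left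
    exact (hi.mul_left hg).mul_left hi'
  · have hi := (commute_lastStrand_gen (N := N) (by omega : j + 1 < i)).inv_left
    have hi' := commute_lastStrand_gen (N := N) (by omega : j + 1 < i + 1)
    have hg : Commute (gen (N + 1) i)⁻¹ (gen (N + 1) j) := (commute_gen (by omega)).symm.inv_left
    exact (hi.mul_left hg).mul_left hi'

theorem semiconjBy_gen_loop (hj : j + 1 < N) :
    SemiconjBy (gen (N + 1) j) (loop N (j + 1)) (loop N j) := by
  have hL := (commute_lastStrand_gen (N := N) (by omega : j + 1 < j + 2)).symm
  rw [loop_eq hj, loop_eq_of_succ_lt hj]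
  refine (SemiconjBy.mul_right hL.inv_right ?_).mul_right hL
  have hsemi : SemiconjBy (gen (N + 1) (j + 1) * gen (N + 1) j) (gen (N + 1) (j + 1))
      (gen (N + 1) j) := by
    rw [SemiconjBy, ← gen_mul_gen_succ_mul_gen (by omega), mul_assoc]
  have hsq := (hsemi.pow_right 2).inv_right.eq
  rw [SemiconjBy, mul_assoc, mul_assoc, ← hsq]
  group

theorem commute_gen_loop_mul_loop (hj : j + 1 < N) :
    Commute (gen (N + 1) j) (loop N j * loop N (j + 1)) := by
  have hL := (commute_lastStrand_gen (N := N) (by omega : j + 1 < j + 2)).symm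
  have hprod : loop N j * loop N (j + 1) = (lastStrand N (j + 2))⁻¹ * (gen (N + 1) (j + 1) *
      gen (N + 1) j * (gen (N + 1) j * gen (N + 1) (j + 1)))⁻¹ * lastStrand N (j + 2) := by
    rw [loop_eq hj, loop_eq_of_succ_lt hj]
    group
  have hbraid := gen_mul_gen_succ_mul_gen (by omega : j + 1 < N + 1 - 1)
  rw [hprod]
  refine (hL.inv_right.mul_right (Commute.inv_right ?_)).mul_right hL
  generalize gen (N + 1) j = s, gen (N + 1) (j + 1) = t at hbraid
  calc s * (t * s * (s * t)) = s * t * s * (s * t) := by simp only [mul_assoc]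
    _ = t * s * (t * s * t) := by rw [hbraid, mul_assoc (t * s), ← mul_assoc t s t]
    _ = t * s * (s * t) * s := by rw [← hbraid]; simp only [mul_assoc]

theorem pushHom_of (h : i < N) : pushHom N (of i) = loop N i := by simp [pushHom, h]

theorem pushHom_of_le (h : N ≤ i) : pushHom N (of i) = 1 := by simp [pushHom, h]

theorem semiconjBy_gen_pushHom (hj : j < N - 1) (f : FreeGroup ℕ) :
    SemiconjBy (gen (N + 1) j) (pushHom N f) (pushHom N (artinAut j f)) := by
  have hof (i : ℕ) :
      SemiconjBy (gen (N + 1) j) (pushHom N (of i)) (pushHom N (artinAut j (of i))) := by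
    have hsucc := semiconjBy_gen_loop (by omega : j + 1 < N)
    by_cases h : i = j
    · have hmul := SemiconjBy.mul_right
        (commute_gen_loop_mul_loop (by omega : j + 1 < N)) hsucc.inv_right
      rw [mul_inv_cancel_right] at hmul
      rwa [h, artinAut_of_self, arc, map_mul, map_mul, map_inv, pushHom_of (by omega),
        pushHom_of (by omega)]
    by_cases h' : i = j + 1
    · rwa [h', artinAut_of_succ, pushHom_of (by omega), pushHom_of (by omega)]
    rw [artinAut_of_ne h h']
    rcases lt_or_ge i N with hi | hi
    · rw [pushHom_of hi]
      exact (commute_loop_gen hi hj h h').symm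
    · rw [pushHom_of_le hi]
      exact SemiconjBy.one_right _
  induction f using FreeGroup.induction_on with
  | C1 => simp
  | of i => exact hof i
  | inv_of i h => simpa using h.inv_right
  | mul f g hf hg => simpa using hf.mul_right hg

theorem semiconjBy_incl_pushHom (b : Braid N) (f : FreeGroup ℕ) :
    SemiconjBy (incl N b) (pushHom N f) (pushHom N (artin N b f)) := by
  have hb : b ∈ tail N 0 := by simp [tail_zero]
  induction hb using Subgroup.closure_induction generalizing f with
  | mem _ h =>
    obtain ⟨j, hj, rfl⟩ := h
    rw [incl_gen hj.2, artin_gen hj.2]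
    exact semiconjBy_gen_pushHom hj.2 f
  | one => simp
  | mul b c _ _ hb hc =>
    rw [map_mul, map_mul]
    exact (hb _).mul_left (hc f)
  | inv b _ hb =>
    rw [map_inv]
    simpa using (hb (artin N b⁻¹ f)).inv_symm_left

/-- The braids of the form `pushHom N f * incl N b`, as images of a semidirect product: they form
the subgroup of braids that fix the place of the last strand. -/
noncomputable def combHom (N : ℕ) : FreeGroup ℕ ⋊[artin N] Braid N →* Braid (N + 1) :=
  SemidirectProduct.lift (pushHom N) (incl N) fun b => MonoidHom.ext fun f =>
    (eq_mul_inv_of_mul_eq (semiconjBy_incl_pushHom b f).eq.symm)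

theorem exists_gen_mul_lastStrand (hi : i ≤ N) (hj : j < N) :
    ∃ k, gen (N + 1) j * lastStrand N i = lastStrand N (Equiv.swap j (j + 1) i) * combHom N k := by
  rcases lt_trichotomy i j with h | rfl | h
  · obtain ⟨j, rfl⟩ := Nat.exists_eq_add_one_of_ne_zero (by omega : j ≠ 0)
    refine ⟨.inr (gen N j), ?_⟩
    rw [Equiv.swap_apply_of_ne_of_ne (by omega) (by omega), combHom, SemidirectProduct.lift_inr,
      incl_gen (by omega), semiconjBy_lastStrand_gen (by omega) hj]
  · refine ⟨(.inl (of i))⁻¹, ?_⟩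
    rw [Equiv.swap_apply_left, map_inv, combHom, SemidirectProduct.lift_inl, pushHom_of hj, loop]
    group
  · rcases Nat.lt_or_ge (j + 1) i with h' | h'
    · refine ⟨.inr (gen N j), ?_⟩
      rw [Equiv.swap_apply_of_ne_of_ne (by omega) (by omega), combHom, SemidirectProduct.lift_inr,
        incl_gen (by omega), (commute_lastStrand_gen h').eq]
    · obtain rfl : i = j + 1 := by omega
      refine ⟨1, ?_⟩
      rw [Equiv.swap_apply_right, map_one, mul_one, ← lastStrand_of_lt hj]

theorem swap_le (hi : i ≤ N) (hj : j < N) : Equiv.swap j (j + 1) i ≤ N := by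
  grind

theorem exists_combing (g : Braid (N + 1)) : ∃ i ≤ N, ∃ k, g = lastStrand N i * combHom N k := by
  have hg : g ∈ tail (N + 1) 0 := by simp [tail_zero]
  induction hg using Subgroup.closure_induction_left with
  | one => exact ⟨N, le_rfl, 1, by simp [lastStrand_self]⟩
  | mul_left _ h g _ ih =>
    obtain ⟨j, hj, rfl⟩ := h
    obtain ⟨i, hi, k, rfl⟩ := ih
    obtain ⟨k', hk'⟩ := exists_gen_mul_lastStrand hi hj.2
    exact ⟨_, swap_le hi hj.2, k' * k, by rw [← mul_assoc, hk', mul_assoc, map_mul]⟩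
  | inv_mul_cancel _ h g _ ih =>
    obtain ⟨j, hj, rfl⟩ := h
    obtain ⟨i, hi, k, rfl⟩ := ih
    obtain ⟨k', hk'⟩ := exists_gen_mul_lastStrand (swap_le hi hj.2) hj.2
    refine ⟨_, swap_le hi hj.2, k'⁻¹ * k, ?_⟩
    rw [Equiv.swap_apply_self] at hk'
    rw [inv_mul_eq_iff_eq_mul, ← mul_assoc, hk', map_mul, map_inv]
    group

theorem artin_incl_of_last (b : Braid N) : artin (N + 1) (incl N b) (of N) = of N := by
  rw [artin_incl, artin_of_le b le_rfl]

theorem artin_lastStrand_of_last (hi : i ≤ N) : artin (N + 1) (lastStrand N i) (of N) = of i := by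
  induction hi using Nat.decreasingInduction with
  | self => simp [lastStrand_self]
  | of_succ i hi ih =>
    rw [lastStrand_of_lt hi, map_mul, MulAut.mul_apply, ih, artin_gen (by omega),
      artinAut_of_succ]

theorem artin_lastStrand_of_lt (hi : i ≤ N) (hj : j < i) :
    artin (N + 1) (lastStrand N i) (of j) = of j := by
  induction hi using Nat.decreasingInduction with
  | self => simp [lastStrand_self]
  | of_succ i hi ih =>
    rw [lastStrand_of_lt hi, map_mul, MulAut.mul_apply, ih (by omega), artin_gen (by omega),
      artinAut_of_ne (by omega) (by omega)]

end Combing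

/-- The homomorphism that kills the free generators with index at least `N`. -/
def trunc (N : ℕ) : FreeGroup ℕ →* FreeGroup ℕ :=
  FreeGroup.lift fun j => if j < N then of j else 1

/-- The braid `g` conjugates the last generator, by `f⁻¹` modulo the last generator, and fixes the
other ones modulo the last generator. This is how `f` is read off from `g = pushHom N f`. -/
def Pushes (N : ℕ) (g : Braid (N + 1)) (f : FreeGroup ℕ) : Prop :=
  (∃ A, artin (N + 1) g (of N) = arc A N ∧ trunc N A = (trunc N f)⁻¹) ∧
    ∀ z, trunc N (artin (N + 1) g z) = trunc N z

section Faithful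

variable {N i : ℕ}

theorem trunc_of_lt (h : i < N) : trunc N (of i) = of i := by simp [trunc, h]

theorem trunc_of_le (h : N ≤ i) : trunc N (of i) = 1 := by simp [trunc, h]

theorem pushHom_trunc (f : FreeGroup ℕ) : pushHom N (trunc N f) = pushHom N f := by
  suffices h : (pushHom N).comp (trunc N) = pushHom N from DFunLike.congr_fun h f
  refine FreeGroup.ext_hom _ _ fun i => ?_
  rcases lt_or_ge i N with h | h
  · rw [MonoidHom.comp_apply, trunc_of_lt h]
  · rw [MonoidHom.comp_apply, trunc_of_le h, pushHom_of_le h, map_one]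

theorem Pushes.one (N : ℕ) : Pushes N 1 1 := ⟨⟨1, by simp [one_arc]⟩, by simp⟩

theorem Pushes.mul {g g' : Braid (N + 1)} {f f' : FreeGroup ℕ} (h : Pushes N g f)
    (h' : Pushes N g' f') : Pushes N (g * g') (f * f') := by
  obtain ⟨⟨A, hA, hAf⟩, hz⟩ := h
  obtain ⟨⟨B, hB, hBf⟩, hz'⟩ := h'
  refine ⟨⟨artin (N + 1) g B * A, ?_, ?_⟩, fun z => ?_⟩
  · rw [map_mul, MulAut.mul_apply, hB]
    exact map_arc (artin (N + 1) g).toMonoidHom hA B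
  · rw [map_mul, hz, hBf, hAf, map_mul, mul_inv_rev]
  · rw [map_mul, MulAut.mul_apply, hz, hz']

theorem Pushes.inv {g : Braid (N + 1)} {f : FreeGroup ℕ} (h : Pushes N g f) :
    Pushes N g⁻¹ f⁻¹ := by
  obtain ⟨⟨A, hA, hAf⟩, hz⟩ := h
  have hz' : ∀ z, trunc N (artin (N + 1) g⁻¹ z) = trunc N z := fun z => by
    rw [← hz, ← artin_inv_apply_eq_iff.1 rfl]
  refine ⟨⟨artin (N + 1) g⁻¹ A⁻¹, ?_, ?_⟩, hz'⟩
  · rw [artin_inv_apply_eq_iff, arc, map_mul, map_mul, ← artin_inv_apply_eq_iff.1 rfl, hA, arc]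
    rw [map_inv (artin (N + 1) g), ← artin_inv_apply_eq_iff.1 rfl]
    group
  · rw [hz', map_inv, hAf, map_inv]

theorem artinAut_inv_artinAut_inv_of_succ (i : ℕ) :
    (artinAut i)⁻¹ ((artinAut i)⁻¹ (of (i + 1))) = arc (of i * of (i + 1))⁻¹ (i + 1) := by
  simp only [artinAut_inv_of_succ, artinAut_inv_of_self, arc, map_mul, map_inv]
  group

theorem map_artinAut_inv_artinAut_inv {G : Type*} [Group G] {r : FreeGroup ℕ →* G}
    (h : r (of (i + 1)) = 1) (z : FreeGroup ℕ) :
    r ((artinAut i)⁻¹ ((artinAut i)⁻¹ z)) = r z := by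
  suffices h : (r.comp (artinAut i)⁻¹.toMonoidHom).comp (artinAut i)⁻¹.toMonoidHom = r from
    DFunLike.congr_fun h z
  refine FreeGroup.ext_hom _ _ fun j => ?_
  change r ((artinAut i)⁻¹ ((artinAut i)⁻¹ (of j))) = r (of j)
  rcases eq_or_ne j i with rfl | hj
  · rw [artinAut_inv_of_self, artinAut_inv_of_succ]
    simp [arc, h]
  rcases eq_or_ne j (i + 1) with rfl | hj'
  · rw [artinAut_inv_artinAut_inv_of_succ]
    simp [arc, h]
  · rw [artinAut_inv_of_ne hj hj', artinAut_inv_of_ne hj hj']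

theorem pushes_loop (hi : i < N) : Pushes N (loop N i) (of i) := by
  set L := lastStrand N (i + 1)
  have hloop : ∀ z, artin (N + 1) (loop N i) z =
      artin (N + 1) L⁻¹ ((artinAut i)⁻¹ ((artinAut i)⁻¹ (artin (N + 1) L z))) := by
    intro z
    rw [loop_eq hi, sq, mul_inv_rev, map_mul, map_mul, map_mul, map_inv _ (gen _ _),
      artin_gen (by omega)]
    rfl
  have hlast : artin (N + 1) L (of N) = of (i + 1) := artin_lastStrand_of_last (by omega)
  have hlt : artin (N + 1) L (of i) = of i := artin_lastStrand_of_lt (by omega) (by omega)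
  refine ⟨⟨(of i * of N)⁻¹, ?_, by simp [trunc_of_lt hi, trunc_of_le le_rfl]⟩, fun z => ?_⟩
  · rw [hloop, hlast, artinAut_inv_artinAut_inv_of_succ, artin_inv_apply_eq_iff]
    simp [arc, hlast, hlt]
  · have hr : trunc N (artin (N + 1) L⁻¹ (of (i + 1))) = 1 := by
      rw [artin_inv_apply_eq_iff.2 hlast.symm, trunc_of_le le_rfl]
    have hsq := map_artinAut_inv_artinAut_inv
      (r := (trunc N).comp (artin (N + 1) L⁻¹).toMonoidHom) hr (artin (N + 1) L z)
    rw [hloop]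
    exact hsq.trans (congrArg _ (artin_inv_apply_eq_iff.2 rfl))

theorem pushes_pushHom (N : ℕ) (f : FreeGroup ℕ) : Pushes N (pushHom N f) f := by
  have hof : ∀ i, Pushes N (pushHom N (of i)) (of i) := by
    intro i
    rcases lt_or_ge i N with h | h
    · rw [pushHom_of h]
      exact pushes_loop h
    · rw [pushHom_of_le h]
      exact ⟨⟨1, by simp [one_arc], by simp [trunc_of_le h]⟩, by simp⟩
  induction f using FreeGroup.induction_on with
  | C1 => simpa using Pushes.one N
  | of i => exact hof i
  | inv_of i h => simpa using h.inv
  | mul f g hf hg => simpa using hf.mul hg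

/-- The proof maps the generator `N` to an element of the wreath product `ℤ ≀ F` whose commutation
with an element forces the image of the latter in `F` to be trivial. -/
theorem trunc_eq_one_of_arc_eq {A : FreeGroup ℕ} (h : arc A N = of N) : trunc N A = 1 := by
  let t : Multiplicative ℤ := .ofAdd 1
  let d : RegularWreathProduct (Multiplicative ℤ) (FreeGroup ℕ) := ⟨Pi.mulSingle 1 t, 1⟩
  let φ : FreeGroup ℕ →* RegularWreathProduct (Multiplicative ℤ) (FreeGroup ℕ) :=
    FreeGroup.lift fun j =>
      if j < N then RegularWreathProduct.inl (of j) else if j = N then d else 1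
  have hright : ∀ z, (φ z).right = trunc N z := by
    intro z
    suffices e : RegularWreathProduct.rightHom.comp φ = trunc N from DFunLike.congr_fun e z
    refine FreeGroup.ext_hom _ _ fun j => ?_
    by_cases h₁ : j < N
    · simp [φ, trunc, h₁]
    · by_cases h₂ : j = N <;> simp [φ, trunc, h₁, h₂, d]
  have hN : φ (of N) = d := by simp [φ]
  have hcomm : φ A * d = d * φ A := by
    rw [← hN, ← map_mul, ← map_mul, ← mul_inv_eq_iff_eq_mul.1 h]
  have hleft := congrArg (fun r => r.left 1) hcomm
  simp only [RegularWreathProduct.mul_left, Pi.mul_apply, d, mul_one, inv_one, hright] at hleft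
  rw [mul_comm, mul_left_inj, Pi.mulSingle_eq_same] at hleft
  by_contra hne
  rw [Pi.mulSingle_eq_of_ne (by simpa using hne)] at hleft
  exact absurd hleft (by decide : (1 : Multiplicative ℤ) ≠ Multiplicative.ofAdd 1)

theorem artin_injective (m : ℕ) : Function.Injective (artin m) := by
  rw [injective_iff_map_eq_one]
  induction m with
  | zero =>
    intro g _
    have hg : g ∈ tail 0 0 := by simp [tail_zero]
    simpa [tail_eq_bot] using hg
  | succ N ih =>
    intro g hg
    obtain ⟨i, hi, ⟨f, b⟩, rfl⟩ := exists_combing g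
    change artin (N + 1) (lastStrand N i * (pushHom N f * incl N b)) = 1 at hg
    change lastStrand N i * (pushHom N f * incl N b) = 1
    obtain ⟨⟨A, hA, hAf⟩, -⟩ := pushes_pushHom N f
    have hN : artin (N + 1) (lastStrand N i) (arc A N) = of N := by
      conv_lhs => rw [← hA, ← artin_incl_of_last b]
      rw [← MulAut.mul_apply, ← MulAut.mul_apply, ← map_mul, ← map_mul, mul_assoc, hg,
        MulAut.one_apply]
    obtain rfl : i = N := by
      have harc := artin_lastStrand_of_last hi
      rw [← one_arc i] at harc
      have := map_arc (artin (N + 1) (lastStrand N i)).toMonoidHom harc A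
      exact eq_of_arc_eq_of (this.symm.trans hN)
    rw [lastStrand_self, map_one, MulAut.one_apply] at hN
    rw [trunc_eq_one_of_arc_eq hN, eq_comm, inv_eq_one] at hAf
    have hf : pushHom i f = 1 := by rw [← pushHom_trunc, hAf, map_one]
    rw [lastStrand_self, hf, one_mul, one_mul] at hg ⊢
    rw [ih b (MulEquiv.ext fun z => by rw [← artin_incl, hg]), map_one]

end Faithful

/-! ### Acyclicity -/

section Acyclic

variable {m i k : ℕ} {β : Braid m}

theorem head?_of_head?_map {α : Type*} [DecidableEq α] {φ : FreeGroup α →* FreeGroup α}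
    (hφ : Function.Injective φ) {W : α × Bool → List (α × Bool)} (hW : ∀ a, mk (W a) = φ (mk [a]))
    {b : α × Bool} (hb : ∀ a, b ∈ W a → a = b ∧ W a = [b]) {u : FreeGroup α}
    (h : (φ u).toWord.head? = some b) : u.toWord.head? = some b := by
  obtain ⟨L₁, a, L₂, P, Q, hu, hWa, hL₁⟩ := exists_of_head?_map hW h
  obtain ⟨rfl, hWa'⟩ := hb a (by simp [hWa])
  obtain rfl : P = [] := by
    rcases P with _ | ⟨p, P⟩
    · rfl
    · simpa using congrArg List.length (hWa.symm.trans hWa')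
  rw [← FreeGroup.one_eq_mk, mul_one] at hL₁
  have hred : IsReduced L₁ := List.IsChain.left_of_append (hu ▸ FreeGroup.isReduced_toWord)
  have hL₁' : L₁ = [] := by
    rw [← toWord_mk_of_isReduced hred, hφ (hL₁.trans (map_one φ).symm), FreeGroup.toWord_one]
  simp [hu, hL₁']

/-- The image of a letter under Artin's automorphism, as a word. -/
def artinWord (k : ℕ) (a : ℕ × Bool) : List (ℕ × Bool) :=
  if a.1 = k then [(k, true), (k + 1, a.2), (k, false)]
  else if a.1 = k + 1 then [(k, a.2)] else [a]

/-- The image of a letter under the inverse of Artin's automorphism, as a word. -/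
def artinInvWord (k : ℕ) (a : ℕ × Bool) : List (ℕ × Bool) :=
  if a.1 = k then [(k + 1, a.2)]
  else if a.1 = k + 1 then [(k + 1, false), (k, a.2), (k + 1, true)] else [a]

theorem mk_eq_map_mk_singleton {α β : Type*} {φ : FreeGroup α →* FreeGroup β}
    {W : α × Bool → List (β × Bool)} (h : ∀ j, mk (W (j, true)) = φ (of j))
    (hinv : ∀ j, W (j, false) = invRev (W (j, true))) (a : α × Bool) : mk (W a) = φ (mk [a]) := by
  obtain ⟨j, _ | _⟩ := a
  · rw [hinv, ← FreeGroup.inv_mk, h, ← map_inv]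
    rfl
  · exact h j

theorem mk_artinWord (k : ℕ) (a : ℕ × Bool) :
    mk (artinWord k a) = (artinAut k).toMonoidHom (mk [a]) := by
  have hinv (j : ℕ) : artinWord k (j, false) = invRev (artinWord k (j, true)) := by
    rw [artinWord, artinWord]
    split_ifs <;> rfl
  refine mk_eq_map_mk_singleton (fun j => ?_) hinv a
  change _ = artinAut k (of j)
  rcases eq_or_ne j k with rfl | h
  · rw [artinAut_of_self, artinWord, if_pos rfl]
    rfl
  rcases eq_or_ne j (k + 1) with rfl | h'
  · rw [artinAut_of_succ, artinWord, if_neg h, if_pos rfl]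
    rfl
  · rw [artinAut_of_ne h h', artinWord, if_neg h, if_neg h']
    rfl

theorem mk_artinInvWord (k : ℕ) (a : ℕ × Bool) :
    mk (artinInvWord k a) = ((artinAut k)⁻¹).toMonoidHom (mk [a]) := by
  have hinv (j : ℕ) : artinInvWord k (j, false) = invRev (artinInvWord k (j, true)) := by
    rw [artinInvWord, artinInvWord]
    split_ifs <;> rfl
  refine mk_eq_map_mk_singleton (fun j => ?_) hinv a
  change _ = (artinAut k)⁻¹ (of j)
  rcases eq_or_ne j k with rfl | h
  · rw [artinAut_inv_of_self, artinInvWord, if_pos rfl]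
    rfl
  rcases eq_or_ne j (k + 1) with rfl | h'
  · rw [artinAut_inv_of_succ, artinInvWord, if_neg h, if_pos rfl]
    rfl
  · rw [artinAut_inv_of_ne h h', artinInvWord, if_neg h, if_neg h']
    rfl

theorem head?_of_head?_artinAut (h : i < k) {u : FreeGroup ℕ}
    (hu : (artinAut k u).toWord.head? = some (i, true)) : u.toWord.head? = some (i, true) :=
  head?_of_head?_map (φ := (artinAut k).toMonoidHom) (artinAut k).injective (mk_artinWord k)
    (by grind [artinWord]) hu

theorem head?_of_head?_artinAut_inv (h : i < k) {u : FreeGroup ℕ}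
    (hu : ((artinAut k)⁻¹ u).toWord.head? = some (i, true)) :
    u.toWord.head? = some (i, true) :=
  head?_of_head?_map (φ := ((artinAut k)⁻¹).toMonoidHom) ((artinAut k)⁻¹).injective
    (mk_artinInvWord k) (by grind [artinInvWord]) hu

theorem head?_of_head?_artinAut_inv_self {u : FreeGroup ℕ}
    (hu : ((artinAut i)⁻¹ u).toWord.head? = some (i, true)) :
    u.toWord.head? = some (i, true) := by
  obtain ⟨L₁, a, L₂, P, Q, hL, hWa, hL₁⟩ :=
    exists_of_head?_map (φ := ((artinAut i)⁻¹).toMonoidHom) (mk_artinInvWord i) hu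
  obtain rfl : P = [(i + 1, false)] := by
    clear hL hL₁
    have hlen : (artinInvWord i a).length ≤ 3 := by grind [artinInvWord]
    rcases P with _ | ⟨p, _ | ⟨q, _ | ⟨r, P⟩⟩⟩ <;> grind [artinInvWord]
  have hof : mk L₁ = of i := by
    refine (artinAut i)⁻¹.injective ?_
    rw [artinAut_inv_of_self]
    exact eq_inv_of_mul_eq_one_left hL₁
  have hred : IsReduced L₁ := List.IsChain.left_of_append (hL ▸ FreeGroup.isReduced_toWord)
  rw [hL, ← toWord_mk_of_isReduced hred, hof, FreeGroup.toWord_of]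
  rfl

theorem head?_artin_of_mem_tail (hβ : β ∈ tail m (i + 1)) (u : FreeGroup ℕ) :
    (artin m β u).toWord.head? = some (i, true) ↔ u.toWord.head? = some (i, true) := by
  induction hβ using Subgroup.closure_induction generalizing u with
  | mem _ h =>
    obtain ⟨k, ⟨hk, hk'⟩, rfl⟩ := h
    rw [artin_gen hk']
    refine ⟨head?_of_head?_artinAut hk, fun hu => head?_of_head?_artinAut_inv hk ?_⟩
    rwa [← MulAut.mul_apply, inv_mul_cancel]
  | one => rw [map_one, MulAut.one_apply]
  | mul β γ _ _ hβ hγ => rw [map_mul, MulAut.mul_apply, hβ, hγ]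
  | inv β _ hβ =>
    rw [← hβ, ← MulAut.mul_apply, ← map_mul, mul_inv_cancel, map_one, MulAut.one_apply]

theorem head?_artin_of_mem_weaklyPositive (hi : i < m - 1) (hβ : β ∈ weaklyPositive m i)
    {u : FreeGroup ℕ} (hu : u.toWord.head? = some (i, true)) :
    (artin m β u).toWord.head? = some (i, true) := by
  induction hβ using Submonoid.closure_induction generalizing u with
  | mem _ h =>
    rcases h with rfl | h
    · rw [artin_gen hi]
      refine head?_of_head?_artinAut_inv_self ?_
      rwa [← MulAut.mul_apply, inv_mul_cancel]
    · exact (head?_artin_of_mem_tail h u).2 hu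
  | one => rwa [map_one, MulAut.one_apply]
  | mul β γ _ _ hβ hγ =>
    rw [map_mul, MulAut.mul_apply]
    exact hβ (hγ hu)

theorem gen_mul_ne_one (hi : i < m - 1) (hβ : β ∈ weaklyPositive m i) : gen m i * β ≠ 1 := by
  intro h
  have hfix : artin m β (of i) = of (i + 1) := by
    rw [eq_inv_of_mul_eq_one_right h, map_inv, artin_gen hi, artinAut_inv_of_self]
  have hhead := head?_artin_of_mem_weaklyPositive hi hβ (u := of i) (by simp)
  simp [hfix] at hhead

end Acyclic

/-! ### Taut braids -/

section Taut

variable {m a i j r : ℕ} {β γ : Braid m} {A : ℕ → FreeGroup ℕ} {k : ℕ → ℕ}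

/-- The total length of the images of the free generators under `β`. -/
def totalNorm (β : Braid m) : ℕ := ∑ j ∈ Finset.range m, (artin m β (of j)).norm

theorem totalNorm_mul_lt (hj : j + 1 < m)
    (hle : ∀ l, (artin m (β * γ) (of l)).norm ≤
      (artin m β (of (Equiv.swap j (j + 1) l))).norm) {l : ℕ} (hl : l < m)
    (hlt : (artin m (β * γ) (of l)).norm < (artin m β (of (Equiv.swap j (j + 1) l))).norm) :
    totalNorm (β * γ) < totalNorm β := by
  have hswap : {l | Equiv.swap j (j + 1) l ≠ l} ⊆ (Finset.range m : Set ℕ) := by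
    intro l hl
    by_contra hlm
    rw [Finset.mem_coe, Finset.mem_range] at hlm
    exact hl (Equiv.swap_apply_of_ne_of_ne (by omega) (by omega))
  have hperm := Equiv.Perm.sum_comp (Equiv.swap j (j + 1)) (Finset.range m)
    (fun l => (artin m β (of l)).norm) hswap
  rw [totalNorm, totalNorm, ← hperm]
  exact Finset.sum_lt_sum (fun l _ => hle l) ⟨l, Finset.mem_range.2 hl, hlt⟩

theorem totalNorm_mul_gen_lt (hj : j + 1 < m)
    (h : (artin m β (of j) * artin m β (of (j + 1)) * (artin m β (of j))⁻¹).norm <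
      (artin m β (of (j + 1))).norm) : totalNorm (β * gen m j) < totalNorm β := by
  have happly (l : ℕ) : artin m (β * gen m j) (of l) = artin m β (artinAut j (of l)) := by
    rw [map_mul, MulAut.mul_apply, artin_gen (by omega)]
  have hself : (artin m (β * gen m j) (of j)).norm <
      (artin m β (of (Equiv.swap j (j + 1) j))).norm := by
    rwa [happly, artinAut_of_self, Equiv.swap_apply_left, arc, map_mul, map_mul, map_inv]
  refine totalNorm_mul_lt hj (fun l => ?_) (by omega) hself
  rcases eq_or_ne l j with rfl | hl
  · exact hself.le
  rcases eq_or_ne l (j + 1) with rfl | hl'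
  · rw [happly, artinAut_of_succ, Equiv.swap_apply_right]
  · rw [happly, artinAut_of_ne hl hl', Equiv.swap_apply_of_ne_of_ne hl hl']

theorem totalNorm_mul_gen_inv_lt (hj : j + 1 < m)
    (h : ((artin m β (of (j + 1)))⁻¹ * artin m β (of j) * artin m β (of (j + 1))).norm <
      (artin m β (of j)).norm) : totalNorm (β * (gen m j)⁻¹) < totalNorm β := by
  have happly (l : ℕ) : artin m (β * (gen m j)⁻¹) (of l) = artin m β ((artinAut j)⁻¹ (of l)) := by
    rw [map_mul, MulAut.mul_apply, map_inv, artin_gen (by omega)]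
  have hsucc : (artin m (β * (gen m j)⁻¹) (of (j + 1))).norm <
      (artin m β (of (Equiv.swap j (j + 1) (j + 1)))).norm := by
    rwa [happly, artinAut_inv_of_succ, Equiv.swap_apply_right, arc, inv_inv, map_mul, map_mul,
      map_inv]
  refine totalNorm_mul_lt hj (fun l => ?_) hj hsucc
  rcases eq_or_ne l (j + 1) with rfl | hl'
  · exact hsucc.le
  rcases eq_or_ne l j with rfl | hl
  · rw [happly, artinAut_inv_of_self, Equiv.swap_apply_left]
  · rw [happly, artinAut_inv_of_ne hl hl', Equiv.swap_apply_of_ne_of_ne hl hl']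

/-- The braid `γ` sends the free generators to the arcs of `A` and `k`, and no two consecutive
ones with index at least `a` can be shortened by a half twist. -/
structure Taut (a : ℕ) (γ : Braid m) (A : ℕ → FreeGroup ℕ) (k : ℕ → ℕ) : Prop where
  tight (j : ℕ) : Tight (A j) (k j)
  artin_of (j : ℕ) : artin m γ (of j) = arc (A j) (k j)
  nonabsorbing (j : ℕ) : a ≤ j → j + 1 < m → Nonabsorbing (A j) (k j) (A (j + 1)) (k (j + 1))

theorem exists_taut (a : ℕ) (β : Braid m) : ∃ h ∈ tail m a, ∃ A k, Taut a (β * h) A k := by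
  obtain ⟨h, hh, hmin⟩ := (InvImage.wf (fun h => totalNorm (β * h)) Nat.lt_wfRel.wf).has_min
    (tail m a : Set (Braid m)) ⟨1, one_mem _⟩
  have hle {g : Braid m} (hg : g ∈ tail m a) : ¬totalNorm (β * h * g) < totalNorm (β * h) := by
    rw [mul_assoc]
    exact hmin _ (mul_mem hh hg)
  choose A k hA hAk using exists_tight_artin (β * h)
  refine ⟨h, hh, A, k, hA, hAk, fun j hj hjm => nonabsorbing_of_norm_le (hA j) (hA (j + 1)) ?_ ?_⟩
    <;> rw [← hAk, ← hAk, ← not_lt] <;> intro hlt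
  · exact hle (gen_mem_tail hj) (totalNorm_mul_gen_lt hjm hlt)
  · exact hle (inv_mem (gen_mem_tail hj)) (totalNorm_mul_gen_inv_lt hjm hlt)

theorem Taut.toWord_artin_rangeProd (h : Taut a γ A k) (hr : r ≤ m - a) :
    (artin m γ (rangeProd a r)).toWord = arcWord A k 1 a r := by
  have hmk := mk_arcWord (φ := (artin m γ).toMonoidHom) h.artin_of 1 a r
  rw [inv_one, one_mul] at hmk
  rw [← toWord_mk_of_isReduced
    (isReduced_arcWord_one h.tight fun j hj hj' => h.nonabsorbing j hj (by omega)), hmk]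
  rfl

theorem Taut.exists_mark (h : Taut a γ A k) (hr : r ≤ m - a) {X Y Z : List (ℕ × Bool)}
    (hR : (artin m γ (rangeProd a r)).toWord = X ++ Y ++ Z)
    (hY : (X ++ Y ++ Z).length < 2 * Y.length + r) :
    ∃ Y₁ l Y₂ t, t < r ∧ Y = Y₁ ++ (l, true) :: Y₂ ∧
      artin m γ (arc (rangeProd a t) (a + t)) = arc (FreeGroup.mk (X ++ Y₁)) l := by
  rw [h.toWord_artin_rangeProd hr] at hR
  obtain ⟨Y₁, Y₂, t, ht, hY', hmk⟩ := exists_mark_of_arcWord_eq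
    (φ := (artin m γ).toMonoidHom) h.artin_of hR (by rwa [FreeGroup.norm_one, add_zero])
  refine ⟨Y₁, k (a + t), Y₂, t, ht, hY', ?_⟩
  rw [hmk, inv_one, one_mul]
  exact map_arc (artin m γ).toMonoidHom (h.artin_of (a + t)) _

theorem mem_tail_succ_of_artin_eq (hβ : β ∈ tail m i) (h : artin m β (of i) = of i) :
    β ∈ tail m (i + 1) := by
  obtain ⟨g, hg, A, k, htaut⟩ := exists_taut (i + 1) β
  have hγ : β * g ∈ tail m i := mul_mem hβ (tail_anti (Nat.le_succ i) hg)
  have hi : artin m (β * g) (of i) = of i := by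
    rw [map_mul, MulAut.mul_apply, artin_of_lt hg (Nat.lt_succ_self i), h]
  have hfix : artin m (β * g) (rangeProd (i + 1) (m - (i + 1))) =
      rangeProd (i + 1) (m - (i + 1)) := by
    have hrange := artin_rangeProd hγ (r := m - (i + 1) + 1) (by omega)
    rwa [rangeProd_succ, map_mul, hi, mul_right_inj] at hrange
  have hword := htaut.toWord_artin_rangeProd le_rfl
  rw [hfix, toWord_rangeProd, eq_comm] at hword
  suffices β * g = 1 by
    rw [eq_inv_of_mul_eq_one_left this]
    exact inv_mem hg
  refine artin_injective m (mulAut_ext fun j => ?_)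
  rw [map_one, MulAut.one_apply]
  rcases lt_trichotomy j i with hj | rfl | hj
  · exact artin_of_lt hγ hj
  · exact hi
  rcases lt_or_ge j m with hj' | hj'
  · obtain ⟨hA, hk⟩ := eq_one_and_eq_of_arcWord_eq_range' hword hj (by omega)
    rw [htaut.artin_of, hA, hk, one_arc]
  · exact artin_of_le _ hj'

end Taut

/-! ### Comparison of braids -/

section Comparison

variable {m i r t : ℕ} {β γ : Braid m} {A B : FreeGroup ℕ} {k l : ℕ}

theorem exists_weaklyPositive_arc (ht : i + t + 1 < m) : ∃ g ∈ weaklyPositive m i,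
    artin m g (of i) = arc (rangeProd i (t + 1)) (i + t + 1) := by
  induction t generalizing i with
  | zero =>
    refine ⟨gen m i, gen_mem_weaklyPositive m i, ?_⟩
    rw [artin_gen (by omega), artinAut_of_self, rangeProd_succ, rangeProd_zero, mul_one, add_zero]
  | succ t ih =>
    obtain ⟨g, hg, harc⟩ := ih (i := i + 1) (by omega)
    have hg' := weaklyPositive_le hg
    refine ⟨g * gen m i, mul_mem (mem_weaklyPositive_of_mem_tail hg')
      (gen_mem_weaklyPositive m i), ?_⟩
    rw [map_mul, MulAut.mul_apply, artin_gen (by omega), artinAut_of_self, arc, map_mul, map_mul,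
      map_inv, harc, artin_of_lt hg' (Nat.lt_succ_self i), mul_arc_mul_inv, ← rangeProd_succ,
      add_right_comm i 1 t, add_assoc i t 1]

theorem exists_weaklyNegative_arc (ht : i + t + 1 < m) : ∃ g, g⁻¹ ∈ weaklyPositive m i ∧
    artin m g (of i) = arc (rangeProd (i + 1) t) (i + 1 + t) := by
  have hgen : artin m (gen m i)⁻¹ (of i) = of (i + 1) := by
    rw [map_inv, artin_gen (by omega), artinAut_inv_of_self]
  rcases t with _ | t
  · refine ⟨(gen m i)⁻¹, ?_, ?_⟩
    · rw [inv_inv]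
      exact gen_mem_weaklyPositive m i
    · rw [hgen, rangeProd_zero, one_arc, add_zero]
  · obtain ⟨g, hg, harc⟩ := exists_weaklyPositive_arc (m := m) (i := i + 1) (t := t) (by omega)
    refine ⟨g * (gen m i)⁻¹, ?_, ?_⟩
    · rw [mul_inv_rev, inv_inv]
      exact mul_mem (gen_mem_weaklyPositive m i)
        (mem_weaklyPositive_of_mem_tail (inv_mem (weaklyPositive_le hg)))
    · rw [map_mul, MulAut.mul_apply, hgen, harc, add_assoc (i + 1) t 1]

theorem artin_rangeProd_succ (hγ : γ ∈ tail m i) (hA : artin m γ (of i) = arc A k)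
    (hr : m ≤ i + (r + 1)) :
    artin m γ (rangeProd (i + 1) r) = (arc A k)⁻¹ * rangeProd i (r + 1) := by
  rw [eq_inv_mul_iff_mul_eq, ← hA, ← map_mul, ← rangeProd_succ, artin_rangeProd hγ hr]

theorem toWord_rangeProd_succ (i r : ℕ) :
    (rangeProd i (r + 1)).toWord = (i, true) :: (rangeProd (i + 1) r).toWord := by
  simp [toWord_rangeProd, List.range'_succ]

theorem toWord_arc_inv_mul_rangeProd (hA : Tight A k)
    (h : (arc A k).toWord.head? ≠ some (i, true)) :
    ((arc A k)⁻¹ * rangeProd i (r + 1)).toWord =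
      A.toWord ++ (k, false) :: (A⁻¹.toWord ++ [(i, true)]) ++ (rangeProd (i + 1) r).toWord := by
  obtain ⟨hhead, hof⟩ := not_or.1 (mt head?_toWord_arc.2 h)
  have hmul : (A⁻¹ * rangeProd i (r + 1)).toWord =
      A⁻¹.toWord ++ (rangeProd i (r + 1)).toWord := by
    refine toWord_mul_of_getLast?_ne fun a ha hai => hhead ?_
    rw [toWord_rangeProd_succ, List.head?_cons, Option.some.injEq, Prod.mk.injEq] at hai
    rw [FreeGroup.toWord_inv, getLast?_invRev] at ha
    obtain ⟨b, hb, rfl⟩ := Option.map_eq_some_iff.1 ha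
    rw [hb, hai.1, hai.2, Bool.not_not]
  rw [toWord_arc_inv_mul hA, hmul, toWord_rangeProd_succ]
  · simp
  rw [hmul, List.head?_append, toWord_rangeProd_succ]
  rcases hAw : A⁻¹.toWord.head? with _ | a
  · rw [List.head?_eq_none_iff, FreeGroup.toWord_eq_nil_iff, inv_eq_one] at hAw
    rintro hik
    simp only [List.head?_cons, Option.none_or, Option.some.injEq, Prod.mk.injEq] at hik
    rw [hAw, one_arc, hik.1] at hof
    exact hof rfl
  · rw [Option.some_or, ← hAw]
    exact hA.head?_inv_ne true

theorem Taut.exists_arc_of_head?_ne {A : ℕ → FreeGroup ℕ} {k : ℕ → ℕ} (h : Taut (i + 1) γ A k)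
    (hγ : γ ∈ tail m i) (hhead : (artin m γ (of i)).toWord.head? ≠ some (i, true)) (hi : i < m) :
    ∃ Y₁ l Y₂ t, i + t + 1 < m ∧ (A i)⁻¹.toWord ++ [(i, true)] = Y₁ ++ (l, true) :: Y₂ ∧
      artin m γ (arc (rangeProd i (t + 1)) (i + t + 1)) = arc (A i * FreeGroup.mk Y₁) l := by
  rw [h.artin_of] at hhead
  have hR := toWord_arc_inv_mul_rangeProd (r := m - (i + 1)) (h.tight i) hhead
  rw [← artin_rangeProd_succ hγ (h.artin_of i) (by omega)] at hR
  obtain ⟨Y₁, l, Y₂, t, ht, hY, harc⟩ := h.exists_mark le_rfl hR (by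
    have hinv : (A i)⁻¹.toWord.length = (A i).toWord.length := FreeGroup.norm_inv_eq
    have hrange : (rangeProd (i + 1) (m - (i + 1))).toWord.length = m - (i + 1) :=
      norm_rangeProd _ _
    simp only [List.length_append, List.length_cons, List.length_nil, hinv, hrange]
    omega)
  obtain ⟨Y₁, rfl, hY'⟩ : ∃ Y₁', Y₁ = (k i, false) :: Y₁' ∧
      (A i)⁻¹.toWord ++ [(i, true)] = Y₁' ++ (l, true) :: Y₂ := by
    rcases Y₁ with _ | ⟨y, Y₁⟩
    · simp at hY
    · rw [List.cons_append, List.cons.injEq] at hY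
      exact ⟨Y₁, by rw [hY.1], hY.2⟩
  refine ⟨Y₁, l, Y₂, t, by omega, hY', ?_⟩
  have hcancel : arc (A i) (k i) * FreeGroup.mk ((A i).toWord ++ (k i, false) :: Y₁) =
      A i * FreeGroup.mk Y₁ := by
    have hcons : FreeGroup.mk ((k i, false) :: Y₁) = (of (k i))⁻¹ * FreeGroup.mk Y₁ := rfl
    rw [← FreeGroup.mul_mk, FreeGroup.mk_toWord, hcons, arc]
    group
  rw [rangeProd_succ, ← mul_arc_mul_inv, add_right_comm, map_mul, map_mul, map_inv, harc,
    h.artin_of, mul_arc_mul_inv, hcancel]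

theorem arc_mul_mk_eq_of_or_exists {Y₁ Y₂ : List (ℕ × Bool)}
    (h : A⁻¹.toWord ++ [(i, true)] = Y₁ ++ (l, true) :: Y₂) :
    arc (A * mk Y₁) l = of i ∨
      ∃ B T, A.toWord = B.toWord ++ (l, false) :: T ∧ arc (A * mk Y₁) l = arc B l := by
  rcases List.eq_nil_or_concat Y₂ with rfl | ⟨Y₂, y, rfl⟩
  · left
    obtain ⟨hY₁, hl⟩ := List.append_inj' h rfl
    simp only [List.cons.injEq, Prod.mk.injEq, and_true] at hl
    rw [← hY₁, FreeGroup.mk_toWord, mul_inv_cancel, one_arc, hl]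
  · right
    rw [List.concat_eq_append, ← List.cons_append, ← List.append_assoc] at h
    have hA : A.toWord = invRev Y₂ ++ (l, false) :: invRev Y₁ := by
      rw [← inv_inv A, FreeGroup.toWord_inv, (List.append_inj' h rfl).1]
      simp [invRev]
    have hY₂ : (mk (invRev Y₂)).toWord = invRev Y₂ :=
      toWord_mk_of_isReduced (List.IsChain.left_of_append (hA ▸ FreeGroup.isReduced_toWord))
    refine ⟨mk (invRev Y₂), invRev Y₁, by rw [hY₂, hA], ?_⟩
    have hcons : mk ((l, false) :: invRev Y₁) = (of l)⁻¹ * mk (invRev Y₁) := rfl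
    rw [← FreeGroup.mk_toWord (x := A), hA, ← FreeGroup.mul_mk, hcons,
      ← FreeGroup.inv_mk (L := Y₁), arc, arc]
    group

theorem exists_weaklyPositive_norm_lt (hβ : β ∈ tail m i) (hi : i < m)
    (hhead : (artin m β (of i)).toWord.head? ≠ some (i, true)) :
    ∃ g ∈ weaklyPositive m i, artin m (β * g) (of i) = of i ∨
      (artin m (β * g) (of i)).norm < (artin m β (of i)).norm ∧
        (artin m (β * g) (of i)).toWord.head? ≠ some (i, true) := by
  obtain ⟨h, hh, A, k, htaut⟩ := exists_taut (i + 1) β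
  have hβh : artin m β (of i) = arc (A i) (k i) := by
    rw [← htaut.artin_of, map_mul, MulAut.mul_apply, artin_of_lt hh (Nat.lt_succ_self i)]
  rw [hβh] at hhead ⊢
  obtain ⟨Y₁, l, Y₂, t, ht, hY, harc⟩ := htaut.exists_arc_of_head?_ne
    (mul_mem hβ (tail_anti (Nat.le_succ i) hh)) (by rwa [htaut.artin_of]) hi
  obtain ⟨g, hg, hgi⟩ := exists_weaklyPositive_arc ht
  have hval : artin m (β * (h * g)) (of i) = arc (A i * mk Y₁) l := by
    rw [← mul_assoc, map_mul, MulAut.mul_apply, hgi, harc]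
  refine ⟨h * g, mul_mem (mem_weaklyPositive_of_mem_tail hh) hg, ?_⟩
  rw [hval, or_iff_not_imp_left]
  intro hne
  obtain ⟨B, T, hAB, hB⟩ := (arc_mul_mk_eq_of_or_exists hY).resolve_left hne
  rw [hB] at hne ⊢
  constructor
  · have hlen := congrArg List.length hAB
    rw [List.length_append, List.length_cons, ← FreeGroup.norm, ← FreeGroup.norm] at hlen
    have := norm_arc_le B l
    rw [norm_arc (htaut.tight i)]
    omega
  · intro hBi
    refine hhead (head?_toWord_arc.2 (.inl ?_))
    rw [hAB, List.head?_append, (head?_toWord_arc.1 hBi).resolve_right hne, Option.some_or]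

theorem norm_inv_mul_rangeProd_le (h : A.toWord.head? = some (i, true)) :
    (A⁻¹ * rangeProd i (r + 1)).norm + 1 ≤ A.norm + r := by
  obtain ⟨T, hT⟩ := List.head?_eq_some_iff.1 h
  have hA : A = of i * mk T := by
    rw [← FreeGroup.mk_toWord (x := A), hT]
    rfl
  have hcancel : A⁻¹ * rangeProd i (r + 1) = (mk T)⁻¹ * rangeProd (i + 1) r := by
    rw [hA, rangeProd_succ]
    group
  have hle := FreeGroup.norm_mul_le (mk T)⁻¹ (rangeProd (i + 1) r)
  have hTle : (mk T).norm ≤ T.length := FreeGroup.norm_mk_le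
  have hlen : A.norm = T.length + 1 := congrArg List.length hT
  rw [FreeGroup.norm_inv_eq, norm_rangeProd] at hle
  rw [hcancel]
  omega

theorem toWord_rangeProd_eq_append (hA : Tight A k)
    (h : (A⁻¹ * rangeProd i (r + 1)).toWord.head? = some (k, true)) :
    ∃ F, (rangeProd i (r + 1)).toWord = A.toWord ++ (k, true) :: F := by
  obtain ⟨C, E, F, hC, hF, hEF⟩ := exists_toWord_inv_mul A (rangeProd i (r + 1))
  obtain rfl : E = [] := by
    by_contra hE
    have hlast : E.getLast? = A.toWord.getLast? := by
      rw [hC, List.getLast?_append_of_ne_nil _ hE]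
    rw [hEF, List.head?_append_of_ne_nil, head?_invRev, hlast] at h
    · obtain ⟨a, ha, hak⟩ := Option.map_eq_some_iff.1 h
      exact hA a.2 (by rw [ha, ← (Prod.mk.inj hak).1])
    · simpa [invRev] using hE
  rw [List.append_nil] at hC
  obtain ⟨F', hF'⟩ := List.head?_eq_some_iff.1 (hEF ▸ h)
  exact ⟨F', by rw [hF, hC, ← hF']; rfl⟩

theorem exists_toWord_arc_inv_mul_rangeProd (hA : Tight A k)
    (h : A.toWord.head? = some (i, true)) :
    ∃ Y Z, (Y = A.toWord ∨ Y = A.toWord ++ [(k, false)]) ∧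
      ((arc A k)⁻¹ * rangeProd i (r + 1)).toWord = Y ++ Z ∧
        (Y ++ Z).length < 2 * Y.length + r := by
  have hnorm := norm_inv_mul_rangeProd_le (r := r) h
  rw [FreeGroup.norm, FreeGroup.norm] at hnorm
  by_cases hk : (A⁻¹ * rangeProd i (r + 1)).toWord.head? = some (k, true)
  · obtain ⟨F, hF⟩ := toWord_rangeProd_eq_append hA hk
    have hlen := norm_rangeProd i (r + 1)
    rw [FreeGroup.norm, hF, List.length_append, List.length_cons] at hlen
    have hpos : 0 < A.toWord.length := by
      rw [List.length_pos_iff]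
      rintro hnil
      simp [hnil] at h
    refine ⟨A.toWord, F, .inl rfl, ?_, by rw [List.length_append]; omega⟩
    have htrue : ∀ a ∈ A.toWord ++ (k, true) :: F, a.2 = true := by
      rw [← hF, toWord_rangeProd]
      simp
    have hmk : (arc A k)⁻¹ * rangeProd i (r + 1) = mk (A.toWord ++ F) := by
      have hcons : mk ((k, true) :: F) = of k * mk F := rfl
      rw [← FreeGroup.mk_toWord (x := rangeProd i (r + 1)), hF, ← FreeGroup.mul_mk,
        ← FreeGroup.mul_mk, FreeGroup.mk_toWord, hcons, arc]
      group
    rw [hmk, toWord_mk_of_isReduced (isReduced_of_forall_true fun a ha => htrue a ?_)]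
    simp only [List.mem_append, List.mem_cons] at ha ⊢
    tauto
  · refine ⟨A.toWord ++ [(k, false)], (A⁻¹ * rangeProd i (r + 1)).toWord, .inr rfl, ?_, ?_⟩
    · rw [toWord_arc_inv_mul hA hk, List.append_cons]
    · simp only [List.length_append, List.length_cons, List.length_nil]
      omega

theorem Taut.exists_arc_of_head?_eq {A : ℕ → FreeGroup ℕ} {k : ℕ → ℕ} (h : Taut (i + 1) γ A k)
    (hγ : γ ∈ tail m i) (hhead : (A i).toWord.head? = some (i, true)) (hi : i < m) :
    ∃ Y₁ l Y₂ t, i + t + 1 < m ∧ (A i).toWord = Y₁ ++ (l, true) :: Y₂ ∧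
      artin m γ (arc (rangeProd (i + 1) t) (i + 1 + t)) = arc (FreeGroup.mk Y₁) l := by
  obtain ⟨Y, Z, hY, hR, hlen⟩ := exists_toWord_arc_inv_mul_rangeProd (r := m - (i + 1))
    (h.tight i) hhead
  rw [← artin_rangeProd_succ hγ (h.artin_of i) (by omega)] at hR
  obtain ⟨Y₁, l, Y₂, t, ht, hmark, harc⟩ := h.exists_mark (X := []) le_rfl hR hlen
  obtain ⟨T, hT⟩ : ∃ T, (A i).toWord = Y₁ ++ (l, true) :: T := by
    rcases hY with rfl | rfl
    · exact ⟨Y₂, hmark⟩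
    rcases List.eq_nil_or_concat Y₂ with rfl | ⟨T, y, rfl⟩
    · simpa using (List.append_inj' hmark rfl).2
    · rw [List.concat_eq_append, ← List.cons_append, ← List.append_assoc] at hmark
      exact ⟨T, (List.append_inj' hmark rfl).1⟩
  exact ⟨Y₁, l, T, t, by omega, hT, harc⟩

theorem exists_weaklyNegative_norm_lt (hβ : β ∈ tail m i) (hi : i < m)
    (hhead : (artin m β (of i)).toWord.head? = some (i, true)) (hne : artin m β (of i) ≠ of i) :
    ∃ g, g⁻¹ ∈ weaklyPositive m i ∧
      (artin m (β * g) (of i)).norm < (artin m β (of i)).norm ∧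
        (artin m (β * g) (of i)).toWord.head? = some (i, true) := by
  obtain ⟨h, hh, A, k, htaut⟩ := exists_taut (i + 1) β
  have hβh : artin m β (of i) = arc (A i) (k i) := by
    rw [← htaut.artin_of, map_mul, MulAut.mul_apply, artin_of_lt hh (Nat.lt_succ_self i)]
  rw [hβh] at hhead hne ⊢
  have hAi := (head?_toWord_arc.1 hhead).resolve_right hne
  obtain ⟨Y₁, l, Y₂, t, ht, hY, harc⟩ := htaut.exists_arc_of_head?_eq
    (mul_mem hβ (tail_anti (Nat.le_succ i) hh)) hAi hi
  obtain ⟨g, hg, hgi⟩ := exists_weaklyNegative_arc ht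
  have hval : artin m (β * (h * g)) (of i) = arc (mk Y₁) l := by
    rw [← mul_assoc, map_mul, MulAut.mul_apply, hgi, harc]
  refine ⟨h * g, ?_, ?_⟩
  · rw [mul_inv_rev]
    exact mul_mem hg (mem_weaklyPositive_of_mem_tail (inv_mem hh))
  have hY₁ : (mk Y₁).toWord = Y₁ :=
    toWord_mk_of_isReduced (List.IsChain.left_of_append (hY ▸ FreeGroup.isReduced_toWord))
  rw [hval]
  constructor
  · have hlen := congrArg List.length hY
    rw [List.length_append, List.length_cons, ← FreeGroup.norm] at hlen
    have hle := norm_arc_le (mk Y₁) l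
    rw [FreeGroup.norm, FreeGroup.norm, hY₁] at hle
    rw [norm_arc (htaut.tight i), FreeGroup.norm]
    omega
  · rw [head?_toWord_arc, hY₁]
    rw [hY] at hAi
    rcases Y₁ with _ | ⟨y, Y₁⟩
    · right
      obtain rfl : l = i := (Prod.mk.inj (Option.some.inj hAi)).1
      exact one_arc l
    · exact .inl hAi

theorem mem_weaklyPositive_of_head?_eq (hβ : β ∈ tail m i) (hi : i < m)
    (hhead : (artin m β (of i)).toWord.head? = some (i, true)) : β ∈ weaklyPositive m i := by
  induction hn : (artin m β (of i)).norm using Nat.strong_induction_on generalizing β with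
  | _ n ih =>
  by_cases hfix : artin m β (of i) = of i
  · exact mem_weaklyPositive_of_mem_tail (mem_tail_succ_of_artin_eq hβ hfix)
  obtain ⟨g, hg, hlt, hhead'⟩ := exists_weaklyNegative_norm_lt hβ hi hhead hfix
  have hg' : g ∈ tail m i := inv_mem_iff.1 (weaklyPositive_le hg)
  rw [← mul_inv_cancel_right β g]
  exact mul_mem (ih _ (hn ▸ hlt) (mul_mem hβ hg') hhead' rfl) hg

theorem inv_mem_weaklyPositive_of_head?_ne (hβ : β ∈ tail m i) (hi : i < m)
    (hhead : (artin m β (of i)).toWord.head? ≠ some (i, true)) : β⁻¹ ∈ weaklyPositive m i := by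
  induction hn : (artin m β (of i)).norm using Nat.strong_induction_on generalizing β with
  | _ n ih =>
  obtain ⟨g, hg, h⟩ := exists_weaklyPositive_norm_lt hβ hi hhead
  have hβg : β * g ∈ tail m i := mul_mem hβ (weaklyPositive_le hg)
  rw [← mul_inv_cancel_left g β⁻¹, ← mul_inv_rev]
  refine mul_mem hg ?_
  rcases h with hfix | ⟨hlt, hhead'⟩
  · exact mem_weaklyPositive_of_mem_tail (inv_mem (mem_tail_succ_of_artin_eq hβg hfix))
  · exact ih _ (hn ▸ hlt) hβg hhead' rfl

theorem mem_weaklyPositive_or_inv_mem (hβ : β ∈ tail m i) (hi : i < m) :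
    β ∈ weaklyPositive m i ∨ β⁻¹ ∈ weaklyPositive m i := by
  by_cases hhead : (artin m β (of i)).toWord.head? = some (i, true)
  · exact .inl (mem_weaklyPositive_of_head?_eq hβ hi hhead)
  · exact .inr (inv_mem_weaklyPositive_of_head?_ne hβ hi hhead)

end Comparison

/-! ### The Dehornoy order -/

section Dehornoy

variable {m i : ℕ} {α β γ : Braid m}

theorem wordBraid_append (v w : List (Fin (m - 1) × Bool)) :
    wordBraid (v ++ w) = wordBraid v * wordBraid w := by
  rw [wordBraid, ← FreeGroup.mul_mk, map_mul]
  rfl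

theorem wordBraid_singleton (a : Fin (m - 1) × Bool) :
    wordBraid [a] = cond a.2 (gen m a.1) (gen m a.1)⁻¹ := by
  rw [gen_of_lt a.1.2]
  rcases a with ⟨j, _ | _⟩ <;> rfl

theorem wordBraid_invRev (w : List (Fin (m - 1) × Bool)) :
    wordBraid (invRev w) = (wordBraid w)⁻¹ := by
  rw [wordBraid, ← FreeGroup.inv_mk, map_inv]
  rfl

theorem exists_wordBraid_eq_of_mem_tail (h : β ∈ tail m i) :
    ∃ w : List (Fin (m - 1) × Bool), (∀ a ∈ w, i ≤ a.1) ∧ wordBraid w = β := by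
  induction h using Subgroup.closure_induction with
  | mem _ h =>
    obtain ⟨j, ⟨hij, hj⟩, rfl⟩ := h
    exact ⟨[(⟨j, hj⟩, true)], by simpa using hij, wordBraid_singleton _⟩
  | one => exact ⟨[], by simp, rfl⟩
  | mul _ _ _ _ hv hw =>
    obtain ⟨v, hv, rfl⟩ := hv
    obtain ⟨w, hw, rfl⟩ := hw
    exact ⟨v ++ w, fun a ha => (List.mem_append.1 ha).elim (hv a) (hw a), wordBraid_append v w⟩
  | inv _ _ hw =>
    obtain ⟨w, hw, rfl⟩ := hw
    refine ⟨invRev w, fun a ha => ?_, wordBraid_invRev w⟩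
    simp only [invRev, List.mem_reverse, List.mem_map] at ha
    obtain ⟨b, hb, rfl⟩ := ha
    exact hw b hb

theorem mem_weaklyPositive_iff {i : Fin (m - 1)} : β ∈ weaklyPositive m i ↔
    ∃ w, (i, false) ∉ w ∧ (∀ a ∈ w, i ≤ a.1) ∧ wordBraid w = β := by
  constructor
  · intro h
    induction h using Submonoid.closure_induction with
    | mem _ h =>
      rcases h with rfl | h
      · exact ⟨[(i, true)], by simp, by simp, wordBraid_singleton _⟩
      · obtain ⟨w, hw, hβ⟩ := exists_wordBraid_eq_of_mem_tail h
        exact ⟨w, fun hi => absurd (hw _ hi) (by simp), fun a ha => (Nat.le_of_succ_le (hw a ha)),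
          hβ⟩
    | one => exact ⟨[], by simp, by simp, rfl⟩
    | mul _ _ _ _ hv hw =>
      obtain ⟨v, hv, hv', rfl⟩ := hv
      obtain ⟨w, hw, hw', rfl⟩ := hw
      exact ⟨v ++ w, by simp [hv, hw], fun a ha => (List.mem_append.1 ha).elim (hv' a) (hw' a),
        wordBraid_append v w⟩
  · rintro ⟨w, hw, hw', rfl⟩
    induction w with
    | nil => exact one_mem _
    | cons a w ih =>
      rw [List.mem_cons, not_or] at hw
      rw [List.forall_mem_cons] at hw'
      rw [← List.singleton_append, wordBraid_append, wordBraid_singleton]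
      refine mul_mem ?_ (ih hw.2 hw'.2)
      rcases a with ⟨j, e⟩
      rcases hw'.1.lt_or_eq with hij | rfl
      · refine mem_weaklyPositive_of_mem_tail ?_
        cases e
        exacts [inv_mem (gen_mem_tail hij), gen_mem_tail hij]
      · obtain rfl : e = true := by simpa using hw.1
        exact gen_mem_weaklyPositive m i

theorem dehornoyLT_iff : DehornoyLT α β ↔ ∃ i < m - 1, ∃ γ ∈ weaklyPositive m i,
    ∃ δ ∈ weaklyPositive m i, α⁻¹ * β = γ * gen m i * δ := by
  constructor
  · rintro ⟨w, ⟨i, hi, hneg, hle⟩, hw⟩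
    obtain ⟨u, v, rfl⟩ := List.append_of_mem hi
    simp only [List.mem_append, List.mem_cons, not_or] at hneg hle
    refine ⟨i, i.2, _, mem_weaklyPositive_iff.2 ⟨u, hneg.1, fun a ha => hle a (.inl ha), rfl⟩,
      _, mem_weaklyPositive_iff.2 ⟨v, hneg.2.2, fun a ha => hle a (.inr (.inr ha)), rfl⟩, ?_⟩
    rw [← hw, List.append_cons, wordBraid_append, wordBraid_append, wordBraid_singleton]
    rfl
  · rintro ⟨i, hi, γ, hγ, δ, hδ, h⟩
    obtain ⟨u, hu, hu', rfl⟩ := mem_weaklyPositive_iff (i := ⟨i, hi⟩).1 hγ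
    obtain ⟨v, hv, hv', rfl⟩ := mem_weaklyPositive_iff (i := ⟨i, hi⟩).1 hδ
    refine ⟨u ++ [(⟨i, hi⟩, true)] ++ v, ⟨⟨i, hi⟩, by simp, by simp [hu, hv], ?_⟩, ?_⟩
    · simp only [List.mem_append, List.mem_singleton]
      rintro a ((ha | rfl) | ha)
      exacts [hu' a ha, le_rfl, hv' a ha]
    · rw [h, wordBraid_append, wordBraid_append, wordBraid_singleton]
      rfl

theorem not_dehornoyLT_self (α : Braid m) : ¬DehornoyLT α α := by
  rw [dehornoyLT_iff]
  rintro ⟨i, hi, γ, hγ, δ, hδ, h⟩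
  rw [inv_mul_cancel, mul_assoc, eq_comm, mul_eq_one_comm, mul_assoc] at h
  exact gen_mul_ne_one hi (mul_mem hδ hγ) h

theorem weaklyPositive_anti {j : ℕ} (h : i ≤ j) : weaklyPositive m j ≤ weaklyPositive m i := by
  rcases h.lt_or_eq with h | rfl
  · exact fun _ hβ => mem_weaklyPositive_of_mem_tail (tail_anti h (weaklyPositive_le hβ))
  · exact le_rfl

theorem DehornoyLT.trans (h : DehornoyLT α β) (h' : DehornoyLT β γ) : DehornoyLT α γ := by
  rw [dehornoyLT_iff] at *
  obtain ⟨i, hi, γ₁, hγ₁, δ₁, hδ₁, h⟩ := h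
  obtain ⟨j, hj, γ₂, hγ₂, δ₂, hδ₂, h'⟩ := h'
  have hαγ : α⁻¹ * γ = γ₁ * gen m i * δ₁ * (γ₂ * gen m j * δ₂) := by
    rw [← h, ← h']
    group
  rcases le_total i j with hij | hij
  · refine ⟨i, hi, γ₁, hγ₁, δ₁ * (γ₂ * gen m j * δ₂), mul_mem hδ₁ (weaklyPositive_anti hij ?_),
      by rw [hαγ, mul_assoc _ δ₁]⟩
    exact mul_mem (mul_mem hγ₂ (gen_mem_weaklyPositive m j)) hδ₂
  · refine ⟨j, hj, γ₁ * gen m i * δ₁ * γ₂, mul_mem (weaklyPositive_anti hij ?_) hγ₂, δ₂, hδ₂,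
      by simp only [hαγ, mul_assoc]⟩
    exact mul_mem (mul_mem hγ₁ (gen_mem_weaklyPositive m i)) hδ₁

theorem mem_tail_or_exists_eq_mul_gen_mul (h : β ∈ weaklyPositive m i) :
    β ∈ tail m (i + 1) ∨
      ∃ γ ∈ weaklyPositive m i, ∃ δ ∈ weaklyPositive m i, β = γ * gen m i * δ := by
  induction h using Submonoid.closure_induction with
  | mem _ h =>
    rcases h with rfl | h
    · exact .inr ⟨1, one_mem _, 1, one_mem _, by simp⟩
    · exact .inl h
  | one => exact .inl (one_mem _)
  | mul x y hx hy ihx ihy =>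
    rcases ihx with hx' | ⟨γ, hγ, δ, hδ, rfl⟩
    · rcases ihy with hy' | ⟨γ, hγ, δ, hδ, rfl⟩
      · exact .inl (mul_mem hx' hy')
      · exact .inr ⟨x * γ, mul_mem hx hγ, δ, hδ, by simp only [mul_assoc]⟩
    · exact .inr ⟨γ, hγ, δ * y, mul_mem hδ hy, by simp only [mul_assoc]⟩

theorem mem_tail_or_dehornoyLT (hi : i < m - 1) (h : α⁻¹ * β ∈ weaklyPositive m i) :
    α⁻¹ * β ∈ tail m (i + 1) ∨ DehornoyLT α β :=
  (mem_tail_or_exists_eq_mul_gen_mul h).imp_right fun h => dehornoyLT_iff.2 ⟨i, hi, h⟩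

theorem dehornoyLT_trichotomy (α β : Braid m) : DehornoyLT α β ∨ α = β ∨ DehornoyLT β α := by
  suffices h : ∀ i ≤ m - 1, α⁻¹ * β ∈ tail m i ∨ DehornoyLT α β ∨ DehornoyLT β α by
    rcases h (m - 1) le_rfl with h | h | h
    · rw [tail_eq_bot le_rfl, Subgroup.mem_bot, inv_mul_eq_one] at h
      exact .inr (.inl h)
    · exact .inl h
    · exact .inr (.inr h)
  intro i hi
  induction i with
  | zero => simp [tail_zero]
  | succ i ih =>
    rcases ih (by omega) with h | h
    · rcases mem_weaklyPositive_or_inv_mem h (by omega) with h' | h'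
      · exact (mem_tail_or_dehornoyLT hi h').imp_right .inl
      · rw [mul_inv_rev, inv_inv] at h'
        refine (mem_tail_or_dehornoyLT hi h').imp (fun h => ?_) .inr
        rwa [← inv_mem_iff, mul_inv_rev, inv_inv] at h
    · exact .inr h

instance : IsStrictTotalOrder (Braid m) DehornoyLT where
  trichotomous α β h h' := ((dehornoyLT_trichotomy α β).resolve_left h).resolve_right h'
  irrefl := not_dehornoyLT_self
  trans _ _ _ := DehornoyLT.trans

variable {S : Set (Braid m)}

theorem exists_isDehornoyLeast (hS : S.Finite) (hne : S.Nonempty) :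
    ∃ β, IsDehornoyLeast S β := by
  have : Nonempty S := hne.to_subtype
  obtain ⟨⟨β, hβ⟩, -, hmin⟩ := (hS.wellFoundedOn (r := DehornoyLT)).has_min Set.univ
    Set.univ_nonempty
  exact ⟨β, hβ, fun γ hγ =>
    (dehornoyLT_trichotomy γ β).resolve_left (hmin ⟨γ, hγ⟩ (Set.mem_univ _))⟩

theorem IsDehornoyLeast.unique (hβ : IsDehornoyLeast S β) (hγ : IsDehornoyLeast S γ) : β = γ := by
  by_contra hne
  exact asymm ((hβ.2 γ hγ.1).resolve_left (Ne.symm hne)) ((hγ.2 β hβ.1).resolve_left hne)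

end Dehornoy

/-! ### Plat classes -/

section PlatClass

variable {n : ℕ} {c : Braid (2 * n) → ℕ}

theorem PlatClass.braids_nonempty (C : PlatClass n) : C.braids.Nonempty :=
  Quotient.inductionOn C fun β => ⟨β, rfl⟩

theorem minimalBraids_finite (hc : IsProperComplexity c) (C : PlatClass n) :
    (minimalBraids c C).Finite :=
  (hc (classComplexity c C)).subset fun _ hβ => hβ.2.le

theorem minimalBraids_nonempty (c : Braid (2 * n) → ℕ) (C : PlatClass n) :
    (minimalBraids c C).Nonempty :=
  Nat.sInf_mem (C.braids_nonempty.image c)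

theorem isDehornoyLeast_canonicalRep (hc : IsProperComplexity c) (C : PlatClass n) :
    IsDehornoyLeast (minimalBraids c C) (canonicalRep c C) :=
  Classical.epsilon_spec
    (exists_isDehornoyLeast (minimalBraids_finite hc C) (minimalBraids_nonempty c C))

theorem mk_canonicalRep (hc : IsProperComplexity c) (C : PlatClass n) :
    DoubleCoset.mk (hilden n) (hilden n) (canonicalRep c C) = C :=
  (isDehornoyLeast_canonicalRep hc C).1.1

theorem isStrictTotalOrder_platLT (hc : IsProperComplexity c) :
    IsStrictTotalOrder (PlatClass n) (PlatLT c) :=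
  (RelEmbedding.preimage ⟨canonicalRep c, Function.LeftInverse.injective (mk_canonicalRep hc)⟩
    DehornoyLT).isStrictTotalOrder

end PlatClass

end Plat

theorem proposition3 (n : ℕ) (hn : 1 ≤ n) (c : Plat.Braid (2 * n) → ℕ)
    (hc : Plat.IsProperComplexity c) :
    (∀ C : Plat.PlatClass n,
      (Plat.minimalBraids c C).Finite ∧ (Plat.minimalBraids c C).Nonempty ∧
      (∃! β, Plat.IsDehornoyLeast (Plat.minimalBraids c C) β) ∧
      Plat.IsDehornoyLeast (Plat.minimalBraids c C) (Plat.canonicalRep c C)) ∧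
    IsStrictTotalOrder (Plat.PlatClass n) (Plat.PlatLT c) := by
  refine ⟨fun C => ?_, Plat.isStrictTotalOrder_platLT hc⟩
  have hleast := Plat.isDehornoyLeast_canonicalRep hc C
  exact ⟨Plat.minimalBraids_finite hc C, Plat.minimalBraids_nonempty c C,
    ⟨_, hleast, fun _ hβ => hβ.unique hleast⟩, hleast⟩
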